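/- Let $K\ge 2$ and $d\ge 1$ be integers, let $\mathcal G\in\{\mathcal O(d),\mathcal{SO}(d)\}$, and let $0<a\le b$. For $n=Km$, fix a balanced clustering function $C^*:[n]\to[K]$ (every cluster has exactly $m$ elements) and $R^*_1,\dots,R^*_n\in\mathcal G$. The ground truth $V^*\in\mathbb R^{nd\times Kd}$ is the block matrix whose $(i,k)$ block ($d\times d$) is $R_i^*$ if $C^*(i)=k$ and $0$ otherwise. Let $\mathcal F$ be the set of all matrices of this form built from any balanced clustering and any elements of $\mathcal O(d)$. The stochastic group block model $\mathrm{SGBM}(n,p,q,K,d,\mathcal G)$ generates a symmetric random $A\in\mathbb R^{nd\times nd}$ with $A_{ii}=I_d$ and, independently over the pairs $i<j$: if $C^*(i)=C^*(j)$ then $A_{ij}=R_i^*R_j^{*\top}$ with probability $p$ and $A_{ij}=0$ otherwise; if $C^*(i)\ne C^*(j)$ then with probability $q$ the block $A_{ij}$ is uniformly (Haar) distributed on $\mathcal G$, and $A_{ij}=0$ otherwise; finally $A_{ji}=A_{ij}^\top$. For $X\in\mathbb R^{nd\times Kd}$ let $\mu(X)\in\mathbb R^{n\times K}$ be the matrix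 of the nuclear norms of its $d\times d$ blocks, and let $$\epsilon_{\mathcal O(d)}(V)=\min_{Q}\|V-V^*Q\|_F,$$ where $Q$ ranges over all matrices $\mathrm{bdiag}(U_1,\dots,U_K)(P\otimes I_d)$ with $U_k\in\mathcal O(d)$ and $P$ a $K\times K$ permutation matrix. A sequence of iterates of the generalized power method (GPM) with input $A$ is any sequence $V^0,V^1,\dots$ with $V^0\in\mathcal F$ and $V^{t+1}\in\operatorname{argmin}_{W\in\mathcal F}\|W-AV^t\|_F$ for all $t\ge 0$. **Theorem.** There is $c>0$, depending only on $K,d,\mathcal G,a,b$, such that for every $\chi_0>0$ there is $N$ with the following property. Let $n=Km\ge N$, let $C^*$, $R^*$ be as above, let $\alpha,\beta\in[a,b]$, $p=\frac{\alpha\log n}{n}$, $q=\frac{\beta\log n}{n}$, and let $A$ be generated by $\mathrm{SGBM}(n,p,q,K,d,\mathcal G)$. Then with probability at least $1-n^{-c}$ the following holds simultaneously for all $\chi\ge\chi_0$ and all sequences $V^0,V^1,\dots$ of GPM iterates with input $A$: if (i) $\chi mp>0$ and $\mu(AV^*)_{iC^*(i)}-\mu(AV^*)_{ij}\ge\chi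 mp$ for all $i\in[n]$ and all $j\ne C^*(i)$; (ii) $\mu(AV^*)_{iC^*(i)}\ge\frac{\sqrt{2K\beta}}{\alpha}\,mp$ for all $i\in[n]$; (iii) $\epsilon_{\mathcal O(d)}(V^0)\le\frac{\sqrt m}{\rho}$ for some $\rho>2\sqrt2\sqrt{\frac{d^2}{\chi^2}+\frac{\alpha^2}{2K\beta}}$; then $\epsilon_{\mathcal O(d)}(V^{t+1})\le\frac12\,\epsilon_{\mathcal O(d)}(V^t)$ for every $t\ge 0$. -/

import Mathlib

namespace GPM

open MeasureTheory

/-- The two groups that are synchronized: the orthogonal and the special orthogonal group. -/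
inductive GroupKind : Type
  | orthogonal : GroupKind
  | specialOrthogonal : GroupKind

/-- The orthogonal group `O(d)` (unitary matrices over `ℝ`, where the star is trivial). -/
abbrev OGroup (d : ℕ) : Submonoid (Matrix (Fin d) (Fin d) ℝ) :=
  Matrix.unitaryGroup (Fin d) ℝ

theorem mem_OGroup_iff {d : ℕ} (Q : Matrix (Fin d) (Fin d) ℝ) :
    Q ∈ OGroup d ↔ Q * Q.transpose = 1 ∧ Q.transpose * Q = 1 := by
  have h : star Q = Q.transpose := by
    rw [Matrix.star_eq_conjTranspose, Matrix.conjTranspose_eq_transpose_of_trivial]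
  constructor
  · intro hQ
    refine ⟨?_, ?_⟩
    · rw [← h]; exact Matrix.mem_unitaryGroup_iff.1 hQ
    · rw [← h]; exact Matrix.mem_unitaryGroup_iff'.1 hQ
  · intro hQ
    rw [Matrix.mem_unitaryGroup_iff, h]
    exact hQ.1

/-- The determinant as a homomorphism on `O(d)`. -/
def detHom (d : ℕ) : OGroup d →* ℝ :=
  Matrix.detMonoidHom.comp (OGroup d).subtype

/-- The group `𝒢 ∈ {O(d), SO(d)}`, as a subgroup of `O(d)`; `SO(d)` is the kernel of `det`. -/
def groupOf (d : ℕ) : GroupKind → Subgroup (OGroup d)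
  | GroupKind.orthogonal => ⊤
  | GroupKind.specialOrthogonal => (detHom d).ker

/-- The `d × d` matrix of a group element. -/
def toMat {d : ℕ} {κ : GroupKind} (g : groupOf d κ) : Matrix (Fin d) (Fin d) ℝ :=
  ((g : OGroup d) : Matrix (Fin d) (Fin d) ℝ)

theorem continuous_toMat {d : ℕ} {κ : GroupKind} :
    Continuous (toMat : groupOf d κ → Matrix (Fin d) (Fin d) ℝ) :=
  continuous_subtype_val.comp continuous_subtype_val

instance (d : ℕ) : CompactSpace (OGroup d) := by
  have hcl : IsClosed ((OGroup d : Set (Matrix (Fin d) (Fin d) ℝ))) := isClosed_unitary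
  have hbox : IsCompact (Set.univ.pi fun _ : Fin d => Set.univ.pi fun _ : Fin d =>
      Set.Icc (-1 : ℝ) 1) :=
    isCompact_univ_pi fun _ => isCompact_univ_pi fun _ => isCompact_Icc
  refine isCompact_iff_compactSpace.1 (hbox.of_isClosed_subset hcl ?_)
  intro U hU
  simp only [Set.mem_pi, Set.mem_univ, true_implies]
  intro i j
  have h := entry_norm_bound_of_unitary (𝕜 := ℝ) hU i j
  exact abs_le.1 h

instance (d : ℕ) (κ : GroupKind) : CompactSpace (groupOf d κ) := by
  refine isCompact_iff_compactSpace.1 (IsClosed.isCompact ?_)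
  cases κ with
  | orthogonal => exact isClosed_univ
  | specialOrthogonal =>
    have hc : Continuous (detHom d) := Continuous.matrix_det continuous_subtype_val
    exact isClosed_singleton.preimage hc

instance (d : ℕ) (κ : GroupKind) : MeasurableSpace (groupOf d κ) := borel _

instance (d : ℕ) (κ : GroupKind) : BorelSpace (groupOf d κ) := ⟨rfl⟩

/-- The uniform distribution on `𝒢`: the Haar measure of total mass one. -/
noncomputable def unif (d : ℕ) (κ : GroupKind) : Measure (groupOf d κ) :=
  Measure.haarMeasure ⊤

/-- A balanced clustering function: each of the `K` clusters has exactly `m` members. -/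
def Balanced {n K : ℕ} (m : ℕ) (C : Fin n → Fin K) : Prop :=
  ∀ k, (Finset.univ.filter fun i => C i = k).card = m

/-- The probability space behind the stochastic group block model: independently for each pair,
a Bernoulli edge indicator, with parameter `p` inside a cluster and `q` across clusters, and an
independent uniform element of `𝒢`. Only the pairs `i < j` are used.
(Numbers outside `[0,1]` are clamped; for `0 ≤ p, q ≤ 1` nothing is changed.) -/
noncomputable def sgbmMeasure {n K : ℕ} (d : ℕ) (κ : GroupKind) (p q : ℝ) (C : Fin n → Fin K) :
    Measure (Fin n × Fin n → Bool × groupOf d κ) :=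
  Measure.pi fun e =>
    (ProbabilityTheory.bernoulliMeasure true false
      (Set.projIcc (0 : ℝ) 1 zero_le_one (if C e.1 = C e.2 then p else q))).prod (unif d κ)

/-- The block of the observation above the diagonal (`i < j`). -/
noncomputable def upperBlock {n K d : ℕ} {κ : GroupKind} (C : Fin n → Fin K)
    (R : Fin n → groupOf d κ) (ω : Fin n × Fin n → Bool × groupOf d κ) (i j : Fin n) :
    Matrix (Fin d) (Fin d) ℝ :=
  if (ω (i, j)).1 = true then
    if C i = C j then toMat (R i) * (toMat (R j)).transpose else toMat (ω (i, j)).2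
  else 0

/-- The observation matrix `A ∈ ℝ^{nd × nd}` generated by the stochastic group block model with
clustering function `C` and group elements `R`, as a function of the random outcome `ω`. -/
noncomputable def observation {n K d : ℕ} {κ : GroupKind} (C : Fin n → Fin K)
    (R : Fin n → groupOf d κ) (ω : Fin n × Fin n → Bool × groupOf d κ) :
    Matrix (Fin n × Fin d) (Fin n × Fin d) ℝ :=
  Matrix.of fun x y =>
    (if x.1 = y.1 then (1 : Matrix (Fin d) (Fin d) ℝ)
      else if x.1 < y.1 then upperBlock C R ω x.1 y.1
      else (upperBlock C R ω y.1 x.1).transpose) x.2 y.2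

/-- The matrix in `ℝ^{nd × Kd}` whose `(i, k)` block is `R i` if `C i = k` and `0` otherwise. -/
noncomputable def assemble {n K d : ℕ} {κ : GroupKind} (C : Fin n → Fin K)
    (R : Fin n → groupOf d κ) : Matrix (Fin n × Fin d) (Fin K × Fin d) ℝ :=
  Matrix.of fun x y => if C x.1 = y.1 then toMat (R x.1) x.2 y.2 else 0

/-- The feasible region of `𝒢`: all matrices built from a balanced clustering and elements of
`𝒢`. -/
def feasible (n K d m : ℕ) (κ : GroupKind) : Set (Matrix (Fin n × Fin d) (Fin K × Fin d) ℝ) :=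
  {V | ∃ (C : Fin n → Fin K) (R : Fin n → groupOf d κ), Balanced m C ∧ V = assemble C R}

/-- The relaxed feasible region `𝓕`, with group elements in `O(d)`. -/
abbrev relaxed (n K d m : ℕ) : Set (Matrix (Fin n × Fin d) (Fin K × Fin d) ℝ) :=
  feasible n K d m GroupKind.orthogonal

section Norms

open scoped Matrix.Norms.Frobenius

/-- The Frobenius norm. -/
noncomputable def frobNorm {ι ι' : Type*} [Fintype ι] [Fintype ι'] (X : Matrix ι ι' ℝ) : ℝ := ‖X‖

end Norms

/-- The nuclear norm of a `d × d` matrix: the sum of its singular values. -/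
noncomputable def nuclearNorm {d : ℕ} (X : Matrix (Fin d) (Fin d) ℝ) : ℝ :=
  ∑ k ∈ Finset.range d, (Matrix.toEuclideanLin X).singularValues k

/-- The `(i, k)` block of size `d × d`. -/
def block {n K d : ℕ} (X : Matrix (Fin n × Fin d) (Fin K × Fin d) ℝ) (i : Fin n) (k : Fin K) :
    Matrix (Fin d) (Fin d) ℝ :=
  Matrix.of fun a b => X (i, a) (k, b)

/-- The blockwise nuclear norm `μ(X) ∈ ℝ^{n × K}`. -/
noncomputable def blockNuclear {n K d : ℕ} (X : Matrix (Fin n × Fin d) (Fin K × Fin d) ℝ) :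
    Matrix (Fin n) (Fin K) ℝ :=
  Matrix.of fun i k => nuclearNorm (block X i k)

/-- `W` is a projection of `X` onto `𝓕`, i.e. a minimizer of the Frobenius distance to `X`. -/
def IsProj {n K d : ℕ} (m : ℕ) (X W : Matrix (Fin n × Fin d) (Fin K × Fin d) ℝ) : Prop :=
  W ∈ relaxed n K d m ∧ ∀ W' ∈ relaxed n K d m, frobNorm (W - X) ≤ frobNorm (W' - X)

/-- `V 0, V 1, …` is a sequence generated by the generalized power method on input `A`, `V 0`. -/
def IsGPMSequence {n K d : ℕ} (m : ℕ) (A : Matrix (Fin n × Fin d) (Fin n × Fin d) ℝ)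
    (V : ℕ → Matrix (Fin n × Fin d) (Fin K × Fin d) ℝ) : Prop :=
  V 0 ∈ relaxed n K d m ∧ ∀ t, IsProj m (A * V t) (V (t + 1))

/-- The block diagonal matrix with the given `d × d` diagonal blocks. -/
noncomputable def bdiag {K d : ℕ} {κ : GroupKind} (U : Fin K → groupOf d κ) :
    Matrix (Fin K × Fin d) (Fin K × Fin d) ℝ :=
  Matrix.of fun x y => if x.1 = y.1 then toMat (U x.1) x.2 y.2 else 0

/-- The set of all `bdiag(U) (P ⊗ I_d)`, with `U ∈ 𝒢^K` and `P` a `K × K` permutation matrix. -/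
def symGroup (K d : ℕ) (κ : GroupKind) : Set (Matrix (Fin K × Fin d) (Fin K × Fin d) ℝ) :=
  {Q | ∃ (U : Fin K → groupOf d κ) (σ : Equiv.Perm (Fin K)),
    Q = bdiag U * Matrix.kroneckerMap (fun x y => x * y) (σ.permMatrix ℝ)
      (1 : Matrix (Fin d) (Fin d) ℝ)}

/-- The estimation error `ε_𝒢(V) = min ‖V - V⋆ Q‖_F`, the minimum over all `Q` in the compact
nonempty set of symmetries. -/
noncomputable def estError {n K d : ℕ} (κ : GroupKind)
    (Vstar V : Matrix (Fin n × Fin d) (Fin K × Fin d) ℝ) : ℝ :=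
  ⨅ Q : symGroup K d κ, frobNorm (V - Vstar * (Q : Matrix (Fin K × Fin d) (Fin K × Fin d) ℝ))

/-- `A` preserves `V` (with clustering function `C`) by `δ`-separation. -/
def PreservesBySeparation {n K d : ℕ} (A : Matrix (Fin n × Fin d) (Fin n × Fin d) ℝ)
    (C : Fin n → Fin K) (V : Matrix (Fin n × Fin d) (Fin K × Fin d) ℝ) (δ : ℝ) : Prop :=
  0 < δ ∧ ∀ i j, j ≠ C i → δ ≤ blockNuclear (A * V) i (C i) - blockNuclear (A * V) i j

end GPM

/-!
Let `M` be the observation averaged over edges and rotations. The `(a, b)` entries of the blocks of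
`A - M` form a matrix with independent centred entries of variance at most `max p q`. Removing one
column at a time from `tr ((E Eᵀ) ^ k)` is a rank-one perturbation by a column independent of the
remaining Gram matrix, which gives a recursion for the expected trace; taking `k` of order `log n`
shows that `‖A - M‖` is small compared with `m p`, outside an event of probability `n ^ (-c)`.

Given this, let `V'` be the symmetric copy of `V⋆` nearest to the iterate `V`, and write
`A V = A V' + M (V - V') + (A - M) (V - V')`. Separation makes the first term favour `V'`.
Since `M` is `p V' V'ᵀ` and the optimality of the symmetry makes the diagonal blocks of `V'ᵀ V`
symmetric, the second term changes the advantages only to order `p ‖V - V'‖²`. The third term is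
bounded in operator norm, so comparing the projection of `A V` with `V'` halves the error.

For `SO(1)`, the trivial group, cross edges have mean one rather than zero and `M` is no longer
a Gram matrix; there, separation itself forces `q ≤ 2 p`.
-/

namespace GPM

open Matrix MeasureTheory ProbabilityTheory Filter Topology
open scoped Matrix.Norms.L2Operator

section LogConvex

variable {u : ℕ → ℝ}

lemma pow_succ_le_mul_pow_of_logConvex (h₀ : ∀ i, 0 ≤ u i)
    (hu : ∀ i, u (i + 1) ^ 2 ≤ u i * u (i + 2)) (i : ℕ) :
    u i ^ (i + 1) ≤ u 0 * u (i + 1) ^ i := by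
  induction i with
  | zero => simp
  | succ i ih =>
    rcases (h₀ (i + 1)).eq_or_lt with h | h
    · rw [← h, zero_pow (Nat.succ_ne_zero _)]
      exact mul_nonneg (h₀ 0) (pow_nonneg (h₀ _) _)
    · refine le_of_mul_le_mul_left ?_ (pow_pos h i)
      calc u (i + 1) ^ i * u (i + 1) ^ (i + 2) = (u (i + 1) ^ 2) ^ (i + 1) := by ring
        _ ≤ (u i * u (i + 2)) ^ (i + 1) := pow_le_pow_left₀ (sq_nonneg _) (hu i) _
        _ = u i ^ (i + 1) * u (i + 2) ^ (i + 1) := mul_pow _ _ _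
        _ ≤ u 0 * u (i + 1) ^ i * u (i + 2) ^ (i + 1) :=
          mul_le_mul_of_nonneg_right ih (pow_nonneg (h₀ _) _)
        _ = u (i + 1) ^ i * (u 0 * u (i + 2) ^ (i + 1)) := by ring

lemma exists_geometric_interpolation_of_logConvex (h₀ : ∀ i, 0 ≤ u i)
    (hu : ∀ i, u (i + 1) ^ 2 ≤ u i * u (i + 2)) (k : ℕ) :
    ∃ x : ℝ, 0 ≤ x ∧ (∀ i ≤ k, u i ≤ u 0 * x ^ i) ∧ u 0 * x ^ k = u k := by
  have hstep := pow_succ_le_mul_pow_of_logConvex h₀ hu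
  rcases (h₀ 0).eq_or_lt with hz | hpos
  · have hzero : ∀ i, u i = 0 := fun i => by
      have h := hstep i
      rw [← hz, zero_mul] at h
      exact (pow_eq_zero_iff i.succ_ne_zero).1 (h.antisymm (pow_nonneg (h₀ i) _))
    exact ⟨0, le_rfl, fun i _ => by simp [hzero], by simp [hzero]⟩
  rcases k.eq_zero_or_pos with rfl | hk
  · exact ⟨0, le_rfl, fun i hi => by simp [Nat.le_zero.1 hi], by simp⟩
  have hq : 0 ≤ u k / u 0 := div_nonneg (h₀ k) hpos.le
  have hxk : u 0 * ((u k / u 0) ^ (k : ℝ)⁻¹) ^ k = u k := by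
    rw [Real.rpow_inv_natCast_pow hq hk.ne', mul_div_cancel₀ _ hpos.ne']
  refine ⟨(u k / u 0) ^ (k : ℝ)⁻¹, Real.rpow_nonneg hq _, fun i hi => ?_, hxk⟩
  set x := (u k / u 0) ^ (k : ℝ)⁻¹
  have : 0 ≤ x := Real.rpow_nonneg hq _
  induction hi using Nat.decreasingInduction with
  | self => exact hxk.ge
  | of_succ i _ ih =>
    refine (pow_le_pow_iff_left₀ (h₀ i) (by positivity) i.succ_ne_zero).1 ?_
    calc u i ^ (i + 1) ≤ u 0 * u (i + 1) ^ i := hstep i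
      _ ≤ u 0 * (u 0 * x ^ (i + 1)) ^ i :=
        mul_le_mul_of_nonneg_left (pow_le_pow_left₀ (h₀ _) ih _) hpos.le
      _ = (u 0 * x ^ i) ^ (i + 1) := by ring

end LogConvex

section PowerMoments

variable {ι : Type*} {M : Matrix ι ι ℝ}

lemma transpose_eq_of_posSemidef (hM : M.PosSemidef) : Mᵀ = M := by
  simpa using hM.isHermitian.eq

lemma posSemidef_mul_transpose {ι' : Type*} [Finite ι] [Fintype ι'] (T : Matrix ι ι' ℝ) :
    (T * Tᵀ).PosSemidef := by
  simpa using posSemidef_self_mul_conjTranspose T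

variable [Fintype ι]

lemma dotProduct_self_nonneg (x : ι → ℝ) : 0 ≤ x ⬝ᵥ x :=
  Finset.sum_nonneg fun i _ => mul_self_nonneg (x i)

lemma dotProduct_sq_le (x y : ι → ℝ) : (x ⬝ᵥ y) ^ 2 ≤ (x ⬝ᵥ x) * (y ⬝ᵥ y) := by
  simpa only [dotProduct, sq] using Finset.sum_mul_sq_le_sq_mul_sq Finset.univ x y

lemma dotProduct_transpose_mul_self_mulVec {ι' : Type*} [Fintype ι'] (B : Matrix ι' ι ℝ)
    (x y : ι → ℝ) : x ⬝ᵥ (Bᵀ * B) *ᵥ y = (B *ᵥ x) ⬝ᵥ (B *ᵥ y) := by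
  rw [← mulVec_mulVec, dotProduct_mulVec, vecMul_transpose]

lemma dotProduct_mulVec_nonneg_of_posSemidef (hM : M.PosSemidef) (x : ι → ℝ) :
    0 ≤ x ⬝ᵥ M *ᵥ x := by
  simpa using hM.dotProduct_mulVec_nonneg x

open scoped MatrixOrder in
lemma exists_eq_transpose_mul_self_of_posSemidef (hM : M.PosSemidef) :
    ∃ B : Matrix ι ι ℝ, M = Bᵀ * B := by
  classical
  obtain ⟨B, hB⟩ := CStarAlgebra.nonneg_iff_eq_star_mul_self.1 hM.nonneg
  exact ⟨B, by simpa [star_eq_conjTranspose] using hB⟩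

lemma dotProduct_mulVec_sq_le_of_posSemidef (hM : M.PosSemidef) (x y : ι → ℝ) :
    (x ⬝ᵥ M *ᵥ y) ^ 2 ≤ (x ⬝ᵥ M *ᵥ x) * (y ⬝ᵥ M *ᵥ y) := by
  obtain ⟨B, rfl⟩ := exists_eq_transpose_mul_self_of_posSemidef hM
  simpa only [dotProduct_transpose_mul_self_mulVec] using dotProduct_sq_le (B *ᵥ x) (B *ᵥ y)

lemma dotProduct_mulVec_le_trace_of_posSemidef (hM : M.PosSemidef) (x : ι → ℝ) :
    x ⬝ᵥ M *ᵥ x ≤ (x ⬝ᵥ x) * M.trace := by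
  obtain ⟨B, rfl⟩ := exists_eq_transpose_mul_self_of_posSemidef hM
  calc x ⬝ᵥ (Bᵀ * B) *ᵥ x = ∑ i, (B i ⬝ᵥ x) ^ 2 := by
        rw [dotProduct_transpose_mul_self_mulVec]
        simp only [dotProduct, mulVec, sq]
    _ ≤ ∑ i, (B i ⬝ᵥ B i) * (x ⬝ᵥ x) := Finset.sum_le_sum fun i _ => dotProduct_sq_le _ _
    _ = (x ⬝ᵥ x) * (Bᵀ * B).trace := by
        rw [← Finset.sum_mul, mul_comm, trace_mul_comm]
        rfl

lemma trace_vecMulVec_mul (b : ι → ℝ) (M : Matrix ι ι ℝ) :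
    (vecMulVec b b * M).trace = b ⬝ᵥ M *ᵥ b := by
  rw [trace_mul_comm, mul_vecMulVec, trace_vecMulVec, dotProduct_comm]

variable [DecidableEq ι] {N : Matrix ι ι ℝ}

lemma dotProduct_pow_mulVec_logConvex (hM : M.PosSemidef) (b : ι → ℝ) (i : ℕ) :
    (b ⬝ᵥ (M ^ (i + 1)) *ᵥ b) ^ 2 ≤ (b ⬝ᵥ (M ^ i) *ᵥ b) * (b ⬝ᵥ (M ^ (i + 2)) *ᵥ b) := by
  have hmixed : b ⬝ᵥ (M ^ i) *ᵥ (M *ᵥ b) = b ⬝ᵥ (M ^ (i + 1)) *ᵥ b := by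
    rw [mulVec_mulVec, ← pow_succ]
  have hself : (M *ᵥ b) ⬝ᵥ (M ^ i) *ᵥ (M *ᵥ b) = b ⬝ᵥ (M ^ (i + 2)) *ᵥ b := by
    nth_rewrite 1 [← transpose_eq_of_posSemidef hM]
    rw [mulVec_transpose, ← dotProduct_mulVec, mulVec_mulVec, mulVec_mulVec, ← pow_succ',
      ← pow_succ]
  simpa only [hmixed, hself] using dotProduct_mulVec_sq_le_of_posSemidef (hM.pow i) b (M *ᵥ b)

lemma exists_dotProduct_pow_mulVec_interpolation (hM : M.PosSemidef) (b : ι → ℝ) (k : ℕ) :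
    ∃ x : ℝ, 0 ≤ x ∧ (∀ i ≤ k, b ⬝ᵥ (M ^ i) *ᵥ b ≤ (b ⬝ᵥ b) * x ^ i) ∧
      (b ⬝ᵥ b) * x ^ k = b ⬝ᵥ (M ^ k) *ᵥ b := by
  simpa using exists_geometric_interpolation_of_logConvex (u := fun i => b ⬝ᵥ (M ^ i) *ᵥ b)
    (fun i => dotProduct_mulVec_nonneg_of_posSemidef (hM.pow i) b)
    (dotProduct_pow_mulVec_logConvex hM b) k

lemma dotProduct_mulVec_le_of_trace_pow_le (hM : M.PosSemidef) {k : ℕ} (hk : k ≠ 0)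
    {L : ℝ} (hL : 0 ≤ L) (h : (M ^ k).trace ≤ L ^ k) (x : ι → ℝ) :
    x ⬝ᵥ M *ᵥ x ≤ L * (x ⬝ᵥ x) := by
  obtain ⟨r, hr, hle, hk_eq⟩ := exists_dotProduct_pow_mulVec_interpolation hM x k
  have hfirst : x ⬝ᵥ M *ᵥ x ≤ (x ⬝ᵥ x) * r := by
    simpa using hle 1 (Nat.one_le_iff_ne_zero.2 hk)
  rcases (dotProduct_self_nonneg x).eq_or_lt with hz | hpos
  · simpa [← hz] using hfirst
  have hrL : r ^ k ≤ L ^ k :=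
    (le_of_mul_le_mul_left (hk_eq ▸ dotProduct_mulVec_le_trace_of_posSemidef (hM.pow k) x)
      hpos).trans h
  rw [mul_comm L]
  exact hfirst.trans
    (mul_le_mul_of_nonneg_left ((pow_le_pow_iff_left₀ hr hL hk).1 hrL) hpos.le)

lemma l2_opNorm_le_of_trace_pow_le {ι' : Type*} [Fintype ι'] [DecidableEq ι'] {T : Matrix ι ι' ℝ}
    {τ : ℝ} (hτ : 0 ≤ τ) {k : ℕ} (hk : k ≠ 0) (h : ((T * Tᵀ) ^ k).trace ≤ (τ ^ 2) ^ k) :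
    ‖T‖ ≤ τ := by
  rw [← l2_opNorm_conjTranspose, conjTranspose_eq_transpose_of_trivial, l2_opNorm_def]
  refine ContinuousLinearMap.opNorm_le_bound _ hτ fun x => ?_
  have hquad : (Tᵀ *ᵥ x.ofLp) ⬝ᵥ (Tᵀ *ᵥ x.ofLp) ≤ τ ^ 2 * (x.ofLp ⬝ᵥ x.ofLp) := by
    rw [← dotProduct_transpose_mul_self_mulVec, transpose_transpose]
    exact dotProduct_mulVec_le_of_trace_pow_le (posSemidef_mul_transpose T) hk (sq_nonneg τ) h _
  refine (pow_le_pow_iff_left₀ (norm_nonneg _) (by positivity) two_ne_zero).1 ?_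
  rw [mul_pow, EuclideanSpace.real_norm_sq_eq, EuclideanSpace.real_norm_sq_eq]
  simp only [dotProduct, ← sq] at hquad
  exact hquad

lemma pow_mul_add_pow_succ {A : Type*} [Semiring A] (a c : A) (i k : ℕ) :
    a ^ i * (a + c) ^ (k + 1) = a ^ (i + 1) * (a + c) ^ k + a ^ i * (c * (a + c) ^ k) := by
  rw [pow_succ', pow_succ, add_mul, mul_add, mul_assoc]

/-- The mixed moment `bᵀ Nⁱ (N + b bᵀ)ʲ b` of `N` and its rank-one update. -/
noncomputable def mixedMoment (N : Matrix ι ι ℝ) (b : ι → ℝ) (i j : ℕ) : ℝ :=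
  b ⬝ᵥ (N ^ i * (N + vecMulVec b b) ^ j) *ᵥ b

lemma mixedMoment_zero_left (N : Matrix ι ι ℝ) (b : ι → ℝ) (j : ℕ) :
    mixedMoment N b 0 j = b ⬝ᵥ ((N + vecMulVec b b) ^ j) *ᵥ b := by
  rw [mixedMoment, pow_zero, one_mul]

lemma mixedMoment_zero_right (N : Matrix ι ι ℝ) (b : ι → ℝ) (i : ℕ) :
    mixedMoment N b i 0 = b ⬝ᵥ (N ^ i) *ᵥ b := by
  rw [mixedMoment, pow_zero, mul_one]

lemma mixedMoment_succ (N : Matrix ι ι ℝ) (b : ι → ℝ) (i j : ℕ) :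
    mixedMoment N b i (j + 1)
      = mixedMoment N b (i + 1) j + mixedMoment N b i 0 * mixedMoment N b 0 j := by
  rw [mixedMoment_zero_right, mixedMoment_zero_left, mixedMoment, mixedMoment,
    pow_mul_add_pow_succ, add_mulVec, dotProduct_add]
  congr 1
  rw [← mulVec_mulVec, ← mulVec_mulVec, vecMulVec_mulVec, op_smul_eq_smul, mulVec_smul,
    dotProduct_smul, smul_eq_mul, mul_comm]

lemma mixedMoment_nonneg (hN : N.PosSemidef) (b : ι → ℝ) (i j : ℕ) : 0 ≤ mixedMoment N b i j := by
  have hzero : ∀ i, 0 ≤ mixedMoment N b i 0 := fun i => by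
    rw [mixedMoment_zero_right]
    exact dotProduct_mulVec_nonneg_of_posSemidef (hN.pow i) b
  induction j generalizing i with
  | zero => exact hzero i
  | succ j ih =>
    rw [mixedMoment_succ]
    exact add_nonneg (ih _) (mul_nonneg (hzero i) (ih 0))

lemma mixedMoment_le (hN : N.PosSemidef) (b : ι → ℝ) {x : ℝ} (hx : 0 ≤ x) {k : ℕ}
    (h : ∀ i ≤ k, mixedMoment N b i 0 ≤ (b ⬝ᵥ b) * x ^ i) (i j : ℕ) (hij : i + j ≤ k) :
    mixedMoment N b i j ≤ (b ⬝ᵥ b) * x ^ i * (x + b ⬝ᵥ b) ^ j := by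
  have hb : 0 ≤ b ⬝ᵥ b := dotProduct_self_nonneg b
  induction j generalizing i with
  | zero => simpa using h i (by omega)
  | succ j ih =>
    rw [mixedMoment_succ]
    calc _ ≤ (b ⬝ᵥ b) * x ^ (i + 1) * (x + b ⬝ᵥ b) ^ j
          + (b ⬝ᵥ b) * x ^ i * ((b ⬝ᵥ b) * x ^ 0 * (x + b ⬝ᵥ b) ^ j) :=
          add_le_add (ih (i + 1) (by omega)) (mul_le_mul (h i (by omega)) (ih 0 (by omega))
            (mixedMoment_nonneg hN b 0 j) (by positivity))
      _ = _ := by ring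

lemma add_pow_le_weighted {x y θ : ℝ} (hx : 0 ≤ x) (hy : 0 ≤ y) (hθ : 0 < θ) (k : ℕ) :
    (x + y) ^ k ≤ (1 + θ) ^ k * x ^ k + (1 + θ⁻¹) ^ k * y ^ k := by
  rw [← mul_pow, ← mul_pow]
  rcases le_total y (θ * x) with h | h
  · exact le_add_of_le_of_nonneg (pow_le_pow_left₀ (by positivity) (by linarith) k)
      (by positivity)
  · have hxy : x ≤ θ⁻¹ * y := by rwa [inv_mul_eq_div, le_div_iff₀' hθ]
    exact le_add_of_nonneg_of_le (by positivity)
      (pow_le_pow_left₀ (by positivity) (by linarith) k)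

lemma dotProduct_add_vecMulVec_pow_mulVec_le (hN : N.PosSemidef) (b : ι → ℝ) {θ : ℝ}
    (hθ : 0 < θ) (k : ℕ) :
    b ⬝ᵥ ((N + vecMulVec b b) ^ k) *ᵥ b
      ≤ (1 + θ) ^ k * (b ⬝ᵥ (N ^ k) *ᵥ b) + (1 + θ⁻¹) ^ k * (b ⬝ᵥ b) ^ (k + 1) := by
  obtain ⟨x, hx, h, hk⟩ := exists_dotProduct_pow_mulVec_interpolation hN b k
  have hb : 0 ≤ b ⬝ᵥ b := dotProduct_self_nonneg b
  calc b ⬝ᵥ ((N + vecMulVec b b) ^ k) *ᵥ b ≤ (b ⬝ᵥ b) * (x + b ⬝ᵥ b) ^ k := by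
        simpa [mixedMoment_zero_left] using
          mixedMoment_le hN b hx (by simpa only [mixedMoment_zero_right] using h) 0 k (by omega)
    _ ≤ (b ⬝ᵥ b) * ((1 + θ) ^ k * x ^ k + (1 + θ⁻¹) ^ k * (b ⬝ᵥ b) ^ k) :=
        mul_le_mul_of_nonneg_left (add_pow_le_weighted hx hb hθ k) hb
    _ = _ := by rw [← hk]; ring

lemma trace_pow_mul_vecMulVec_mul_pow (hN : N.PosSemidef) (b : ι → ℝ) (i k : ℕ) :
    (N ^ i * (vecMulVec b b * (N + vecMulVec b b) ^ k)).trace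
      = mixedMoment N b i k := by
  have hS : (N + vecMulVec b b).PosSemidef :=
    hN.add (by simpa using posSemidef_vecMulVec_self_star b)
  rw [mixedMoment, trace_mul_comm, Matrix.mul_assoc, trace_vecMulVec_mul, dotProduct_mulVec,
    ← mulVec_transpose, dotProduct_comm, transpose_mul,
    transpose_eq_of_posSemidef (hS.pow k), transpose_eq_of_posSemidef (hN.pow i)]

lemma trace_pow_le_trace_add_vecMulVec_pow (hN : N.PosSemidef) (b : ι → ℝ) (k : ℕ) :
    (N ^ k).trace ≤ ((N + vecMulVec b b) ^ k).trace := by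
  suffices ∀ j i : ℕ, (N ^ (i + j)).trace ≤ (N ^ i * (N + vecMulVec b b) ^ j).trace by
    simpa using this k 0
  intro j
  induction j with
  | zero => intro i; simp
  | succ j ih =>
    intro i
    rw [pow_mul_add_pow_succ, trace_add, trace_pow_mul_vecMulVec_mul_pow hN, ← add_assoc,
      add_right_comm]
    exact le_add_of_le_of_nonneg (ih (i + 1)) (mixedMoment_nonneg hN b i j)

end PowerMoments

section Columns

variable {ι ι' : Type*} [Fintype ι']

lemma mul_transpose_eq_sum_vecMulVec (T : Matrix ι ι' ℝ) :
    T * Tᵀ = ∑ j, vecMulVec (T.col j) (T.col j) := by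
  ext a b
  simp [mul_apply, Matrix.sum_apply, vecMulVec_apply]

lemma trace_gram_pow_succ [Fintype ι] [DecidableEq ι] (T : Matrix ι ι' ℝ) (k : ℕ) :
    ((T * Tᵀ) ^ (k + 1)).trace = ∑ j, T.col j ⬝ᵥ ((T * Tᵀ) ^ k) *ᵥ T.col j := by
  rw [pow_succ']
  nth_rewrite 1 [mul_transpose_eq_sum_vecMulVec]
  simp_rw [Matrix.sum_mul, trace_sum, trace_vecMulVec_mul]

variable [DecidableEq ι']

/-- The Gram matrix of the columns of `T` other than column `j`; in a random matrix with independent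
entries it is independent of column `j`. -/
noncomputable def gramWithout (T : Matrix ι ι' ℝ) (j : ι') : Matrix ι ι ℝ :=
  T.updateCol j 0 * (T.updateCol j 0)ᵀ

lemma posSemidef_gramWithout [Finite ι] (T : Matrix ι ι' ℝ) (j : ι') :
    (gramWithout T j).PosSemidef :=
  posSemidef_mul_transpose _

lemma continuous_gramWithout (j : ι') : Continuous fun T : Matrix ι ι' ℝ => gramWithout T j :=
  (continuous_id.matrix_updateCol j continuous_const).matrix_mul
    (continuous_id.matrix_updateCol j continuous_const).matrix_transpose

lemma gramWithout_add_vecMulVec (T : Matrix ι ι' ℝ) (j : ι') :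
    gramWithout T j + vecMulVec (T.col j) (T.col j) = T * Tᵀ := by
  rw [gramWithout, mul_transpose_eq_sum_vecMulVec, mul_transpose_eq_sum_vecMulVec,
    ← Finset.sum_erase_add Finset.univ (fun l => vecMulVec (T.col l) (T.col l))
      (Finset.mem_univ j),
    ← Finset.sum_erase Finset.univ (a := j) (by ext; simp [vecMulVec_apply])]
  congr 1
  refine Finset.sum_congr rfl fun l hl => ?_
  ext a b
  simp [vecMulVec_apply, Finset.ne_of_mem_erase hl]

end Columns

section RandomMatrix

variable {Ω ι ι' : Type*} [MeasurableSpace Ω] {μ : Measure Ω} {X : Ω → Matrix ι ι' ℝ} {v : ℝ}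

/-- A random matrix with independent centred entries, bounded by one and of variance at most `v`:
the class of noise matrices for which the operator norm is controlled by trace moments. -/
structure IsCenteredNoise (X : Ω → Matrix ι ι' ℝ) (μ : Measure Ω) (v : ℝ) : Prop where
  indep : iIndepFun (fun (e : ι × ι') ω => X ω e.1 e.2) μ
  measurable : ∀ i j, Measurable fun ω => X ω i j
  abs_le_one : ∀ ω i j, |X ω i j| ≤ 1
  integral_eq_zero : ∀ i j, ∫ ω, X ω i j ∂μ = 0
  integral_sq_le : ∀ i j, ∫ ω, X ω i j ^ 2 ∂μ ≤ v

namespace IsCenteredNoise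

lemma integral_mul_eq_zero (h : IsCenteredNoise X μ v) {i k : ι} {j l : ι'}
    (hne : (i, j) ≠ (k, l)) : ∫ ω, X ω i j * X ω k l ∂μ = 0 := by
  rw [(h.indep.indepFun hne).integral_fun_mul_eq_mul_integral
    (h.measurable i j).aestronglyMeasurable (h.measurable k l).aestronglyMeasurable,
    h.integral_eq_zero, zero_mul]

lemma integrable_of_continuous [Finite ι] [Finite ι'] [IsFiniteMeasure μ]
    (h : IsCenteredNoise X μ v) {F : Matrix ι ι' ℝ → ℝ} (hF : Continuous F) :
    Integrable (fun ω => F (X ω)) μ := by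
  have hbox : IsCompact (Set.univ.pi fun _ : ι => Set.univ.pi fun _ : ι' => Set.Icc (-1 : ℝ) 1) :=
    isCompact_univ_pi fun _ => isCompact_univ_pi fun _ => isCompact_Icc
  obtain ⟨B, hB⟩ := hbox.exists_bound_of_continuousOn
    (f := fun y : ι → ι' → ℝ => F (of y)) hF.continuousOn
  have hX : Measurable fun ω i j => X ω i j :=
    measurable_pi_lambda _ fun i => measurable_pi_lambda _ (h.measurable i)
  have hF' : Continuous fun y : ι → ι' → ℝ => F (of y) := hF
  exact .of_bound (hF'.measurable.comp hX).aestronglyMeasurable B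
    (.of_forall fun ω => hB _ fun i _ j _ => abs_le.1 (h.abs_le_one ω i j))

lemma indepFun_col_updateCol [Finite ι] [Finite ι'] [DecidableEq ι']
    (h : IsCenteredNoise X μ v) (j : ι') {f : (ι → ℝ) → ℝ} (hf : Measurable f)
    {g : Matrix ι ι' ℝ → ℝ} (hg : Continuous g) :
    IndepFun (fun ω => f ((X ω).col j)) (fun ω => g ((X ω).updateCol j 0)) μ := by
  classical
  cases nonempty_fintype ι
  cases nonempty_fintype ι'
  let S : Finset (ι × ι') := {e | e.2 = j}
  let T : Finset (ι × ι') := {e | e.2 ≠ j}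
  have hind := h.indep.indepFun_finset S T (Finset.disjoint_filter_filter_not _ _ _)
    fun e => h.measurable e.1 e.2
  let column : (S → ℝ) → ι → ℝ := fun y i => y ⟨(i, j), by simp [S]⟩
  let others : (T → ℝ) → Matrix ι ι' ℝ :=
    fun y i l => if hl : l = j then 0 else y ⟨(i, l), by simp [T, hl]⟩
  have hcolumn : Measurable column := measurable_pi_lambda _ fun i => measurable_pi_apply _
  have hothers : Continuous others := continuous_matrix fun i l => by
    simp only [others]
    split_ifs <;> fun_prop
  have hupdate : ∀ ω, (X ω).updateCol j 0 = others fun e => X ω e.1.1 e.1.2 := fun ω => by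
    ext i l
    simp only [others, updateCol_apply, Pi.zero_apply]
    split_ifs <;> rfl
  simp_rw [hupdate]
  exact hind.comp (hf.comp hcolumn) (hg.comp hothers).measurable

end IsCenteredNoise

lemma dotProduct_mulVec_eq_sum [Fintype ι] (M : Matrix ι ι ℝ) (x : ι → ℝ) :
    x ⬝ᵥ M *ᵥ x = ∑ a, ∑ b, x a * x b * M a b := by
  simp only [dotProduct, mulVec, Finset.mul_sum]
  exact Finset.sum_congr rfl fun a _ => Finset.sum_congr rfl fun b _ => by ring

lemma exp_le_one_add_two_mul {y : ℝ} (h₀ : 0 ≤ y) (h₁ : y ≤ 1) : Real.exp y ≤ 1 + 2 * y := by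
  have hexp := (abs_le.1 (Real.abs_exp_sub_one_sub_id_le (by rwa [abs_of_nonneg h₀]))).2
  nlinarith

namespace IsCenteredNoise

variable [IsProbabilityMeasure μ]

lemma mgf_sq_le [Finite ι] [Finite ι'] (h : IsCenteredNoise X μ v) (i : ι) (j : ι') :
    mgf (fun ω => X ω i j ^ 2) μ 1 ≤ Real.exp (2 * v) := by
  have hsq : Integrable (fun ω => X ω i j ^ 2) μ :=
    h.integrable_of_continuous (F := fun T => T i j ^ 2) (by fun_prop)
  calc mgf (fun ω => X ω i j ^ 2) μ 1 ≤ ∫ ω, (1 + 2 * X ω i j ^ 2) ∂μ := by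
        refine integral_mono
          (h.integrable_of_continuous (F := fun T => Real.exp (1 * T i j ^ 2)) (by fun_prop))
          ((integrable_const _).add (hsq.const_mul 2)) fun ω => ?_
        rw [one_mul]
        exact exp_le_one_add_two_mul (sq_nonneg _)
          (by simpa using (sq_le_one_iff_abs_le_one _).2 (h.abs_le_one ω i j))
    _ = 2 * ∫ ω, X ω i j ^ 2 ∂μ + 1 := by
        rw [integral_add (integrable_const _) (hsq.const_mul 2), integral_const_mul, add_comm]
        simp
    _ ≤ 2 * v + 1 := by linarith [h.integral_sq_le i j]
    _ ≤ Real.exp (2 * v) := Real.add_one_le_exp _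

variable [Fintype ι]

section

variable [Finite ι']

lemma integral_exp_dotProduct_col_self_le (h : IsCenteredNoise X μ v) (j : ι') :
    ∫ ω, Real.exp ((X ω).col j ⬝ᵥ (X ω).col j) ∂μ ≤ Real.exp (2 * v * Fintype.card ι) := by
  have hindep : iIndepFun (fun i ω => X ω i j ^ 2) μ :=
    (h.indep.precomp (g := fun i : ι => (i, j)) fun a b hab => by simpa using hab).comp
      (fun _ y => y ^ 2) fun _ => by fun_prop
  calc ∫ ω, Real.exp ((X ω).col j ⬝ᵥ (X ω).col j) ∂μ
      = mgf (∑ i, fun ω => X ω i j ^ 2) μ 1 := by simp [mgf, dotProduct, sq]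
    _ = ∏ i, mgf (fun ω => X ω i j ^ 2) μ 1 :=
        hindep.mgf_sum (fun i => (h.measurable i j).pow_const 2) Finset.univ
    _ ≤ ∏ _i : ι, Real.exp (2 * v) :=
        Finset.prod_le_prod (fun i _ => mgf_nonneg) fun i _ => h.mgf_sq_le i j
    _ = Real.exp (2 * v * Fintype.card ι) := by
        rw [Finset.prod_const, Finset.card_univ, ← Real.exp_nat_mul, mul_comm]

lemma integrable_dotProduct_col_self_pow (h : IsCenteredNoise X μ v) (j : ι') (k : ℕ) :
    Integrable (fun ω => ((X ω).col j ⬝ᵥ (X ω).col j) ^ k) μ :=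
  h.integrable_of_continuous (F := fun T => (T.col j ⬝ᵥ T.col j) ^ k)
    (by simp only [dotProduct, col_apply]; fun_prop)

lemma integral_dotProduct_col_self_pow_le (h : IsCenteredNoise X μ v) (j : ι') (k : ℕ) :
    ∫ ω, ((X ω).col j ⬝ᵥ (X ω).col j) ^ k ∂μ
      ≤ k.factorial * Real.exp (2 * v * Fintype.card ι) := by
  calc ∫ ω, ((X ω).col j ⬝ᵥ (X ω).col j) ^ k ∂μ
      ≤ ∫ ω, k.factorial * Real.exp ((X ω).col j ⬝ᵥ (X ω).col j) ∂μ := by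
        refine integral_mono (h.integrable_dotProduct_col_self_pow j k)
          (h.integrable_of_continuous
            (F := fun T => k.factorial * Real.exp (T.col j ⬝ᵥ T.col j))
            (by simp only [dotProduct, col_apply]; fun_prop)) fun ω => ?_
        exact (div_le_iff₀' (by positivity)).1
          (Real.pow_div_factorial_le_exp _ (dotProduct_self_nonneg _) k)
    _ = k.factorial * ∫ ω, Real.exp ((X ω).col j ⬝ᵥ (X ω).col j) ∂μ := integral_const_mul _ _
    _ ≤ k.factorial * Real.exp (2 * v * Fintype.card ι) :=
        mul_le_mul_of_nonneg_left (h.integral_exp_dotProduct_col_self_le j) (Nat.cast_nonneg _)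

end

variable [Fintype ι'] [DecidableEq ι]

lemma integrable_trace_gram_pow (h : IsCenteredNoise X μ v) (k : ℕ) :
    Integrable (fun ω => ((X ω * (X ω)ᵀ) ^ k).trace) μ :=
  h.integrable_of_continuous (F := fun T => ((T * Tᵀ) ^ k).trace)
    ((continuous_id.matrix_mul continuous_id.matrix_transpose).pow k).matrix_trace

variable [DecidableEq ι']

lemma integrable_gramWithout_pow (h : IsCenteredNoise X μ v) (j : ι') (k : ℕ) (a b : ι) :
    Integrable (fun ω => (gramWithout (X ω) j ^ k) a b) μ :=
  h.integrable_of_continuous (F := fun T => (gramWithout T j ^ k) a b)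
    (((continuous_gramWithout j).pow k).matrix_elem a b)

lemma integrable_mul_mul_gramWithout_pow (h : IsCenteredNoise X μ v) (j : ι') (k : ℕ) (a b : ι) :
    Integrable (fun ω => X ω a j * X ω b j * (gramWithout (X ω) j ^ k) a b) μ :=
  h.integrable_of_continuous (F := fun T => T a j * T b j * (gramWithout T j ^ k) a b)
    (((continuous_id.matrix_elem a j).mul (continuous_id.matrix_elem b j)).mul
      (((continuous_gramWithout j).pow k).matrix_elem a b))

lemma integral_mul_mul_gramWithout_pow (h : IsCenteredNoise X μ v) (j : ι') (k : ℕ) (a b : ι) :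
    ∫ ω, X ω a j * X ω b j * (gramWithout (X ω) j ^ k) a b ∂μ
      = (∫ ω, X ω a j * X ω b j ∂μ) * ∫ ω, (gramWithout (X ω) j ^ k) a b ∂μ :=
  (h.indepFun_col_updateCol j (f := fun y => y a * y b) (by fun_prop)
      (g := fun T => ((T * Tᵀ) ^ k) a b)
      (((continuous_id.matrix_mul continuous_id.matrix_transpose).pow k).matrix_elem a
        b)).integral_fun_mul_eq_mul_integral
    ((h.measurable a j).mul (h.measurable b j)).aestronglyMeasurable
    (h.integrable_gramWithout_pow j k a b).aestronglyMeasurable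

lemma integrable_trace_gramWithout_pow (h : IsCenteredNoise X μ v) (j : ι') (k : ℕ) :
    Integrable (fun ω => (gramWithout (X ω) j ^ k).trace) μ :=
  integrable_finsetSum _ fun a _ => h.integrable_gramWithout_pow j k a a

lemma integrable_dotProduct_gramWithout_pow (h : IsCenteredNoise X μ v) (j : ι') (k : ℕ) :
    Integrable (fun ω => (X ω).col j ⬝ᵥ (gramWithout (X ω) j ^ k) *ᵥ (X ω).col j) μ := by
  simp_rw [dotProduct_mulVec_eq_sum]
  exact integrable_finsetSum _ fun a _ => integrable_finsetSum _ fun b _ =>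
    h.integrable_mul_mul_gramWithout_pow j k a b

lemma integral_dotProduct_gramWithout_pow_le (h : IsCenteredNoise X μ v) (j : ι') (k : ℕ) :
    ∫ ω, (X ω).col j ⬝ᵥ (gramWithout (X ω) j ^ k) *ᵥ (X ω).col j ∂μ
      ≤ v * ∫ ω, (gramWithout (X ω) j ^ k).trace ∂μ := by
  have hdiag : ∀ a, ∑ b, ∫ ω, X ω a j * X ω b j * (gramWithout (X ω) j ^ k) a b ∂μ
      = (∫ ω, X ω a j ^ 2 ∂μ) * ∫ ω, (gramWithout (X ω) j ^ k) a a ∂μ := fun a => by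
    rw [Finset.sum_eq_single a (fun b _ hb => ?_) (by simp), h.integral_mul_mul_gramWithout_pow]
    · simp_rw [sq]
    · rw [h.integral_mul_mul_gramWithout_pow,
        h.integral_mul_eq_zero (by simpa using hb.symm), zero_mul]
  simp_rw [dotProduct_mulVec_eq_sum, Matrix.trace, diag_apply, col_apply]
  rw [integral_finsetSum _ fun a _ => integrable_finsetSum _ fun b _ =>
      h.integrable_mul_mul_gramWithout_pow j k a b,
    integral_finsetSum _ fun a _ => h.integrable_gramWithout_pow j k a a, Finset.mul_sum]
  refine Finset.sum_le_sum fun a _ => ?_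
  rw [integral_finsetSum _ fun b _ => h.integrable_mul_mul_gramWithout_pow j k a b, hdiag]
  exact mul_le_mul_of_nonneg_right (h.integral_sq_le a j)
    (integral_nonneg fun ω => ((posSemidef_gramWithout _ _).pow k).diag_nonneg)

lemma integral_trace_gramWithout_pow_le (h : IsCenteredNoise X μ v) (j : ι') (k : ℕ) :
    ∫ ω, (gramWithout (X ω) j ^ k).trace ∂μ ≤ ∫ ω, ((X ω * (X ω)ᵀ) ^ k).trace ∂μ := by
  refine integral_mono (h.integrable_trace_gramWithout_pow j k) (h.integrable_trace_gram_pow k)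
    fun ω => ?_
  simpa only [gramWithout_add_vecMulVec] using
    trace_pow_le_trace_add_vecMulVec_pow (posSemidef_gramWithout (X ω) j) ((X ω).col j) k

end IsCenteredNoise

lemma trace_gram_pow_succ_le [Fintype ι] [Fintype ι'] [DecidableEq ι] [DecidableEq ι']
    (T : Matrix ι ι' ℝ) {θ : ℝ} (hθ : 0 < θ) (k : ℕ) :
    ((T * Tᵀ) ^ (k + 1)).trace
      ≤ ∑ j, ((1 + θ) ^ k * (T.col j ⬝ᵥ (gramWithout T j ^ k) *ᵥ T.col j)
        + (1 + θ⁻¹) ^ k * (T.col j ⬝ᵥ T.col j) ^ (k + 1)) := by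
  rw [trace_gram_pow_succ]
  refine Finset.sum_le_sum fun j _ => ?_
  simpa only [gramWithout_add_vecMulVec] using
    dotProduct_add_vecMulVec_pow_mulVec_le (posSemidef_gramWithout T j) (T.col j) hθ k

namespace IsCenteredNoise

variable [IsProbabilityMeasure μ] [Fintype ι] [Fintype ι'] [DecidableEq ι] {θ : ℝ}

lemma integral_trace_gram_pow_succ_le (h : IsCenteredNoise X μ v) (hv : 0 ≤ v) (hθ : 0 < θ)
    (k : ℕ) :
    ∫ ω, ((X ω * (X ω)ᵀ) ^ (k + 1)).trace ∂μ
      ≤ Fintype.card ι' * ((1 + θ) ^ k * (v * ∫ ω, ((X ω * (X ω)ᵀ) ^ k).trace ∂μ)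
        + (1 + θ⁻¹) ^ k * ((k + 1).factorial * Real.exp (2 * v * Fintype.card ι))) := by
  classical
  have hquad := fun j => (h.integrable_dotProduct_gramWithout_pow j k).const_mul ((1 + θ) ^ k)
  have hnorm := fun j => (h.integrable_dotProduct_col_self_pow j (k + 1)).const_mul
    ((1 + θ⁻¹) ^ k)
  calc ∫ ω, ((X ω * (X ω)ᵀ) ^ (k + 1)).trace ∂μ
      ≤ ∫ ω, ∑ j, ((1 + θ) ^ k * ((X ω).col j ⬝ᵥ (gramWithout (X ω) j ^ k) *ᵥ (X ω).col j)
          + (1 + θ⁻¹) ^ k * ((X ω).col j ⬝ᵥ (X ω).col j) ^ (k + 1)) ∂μ :=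
        integral_mono (h.integrable_trace_gram_pow _)
          (integrable_finsetSum _ fun j _ => (hquad j).add (hnorm j))
          fun ω => trace_gram_pow_succ_le (X ω) hθ k
    _ = ∑ j, ((1 + θ) ^ k * ∫ ω, (X ω).col j ⬝ᵥ (gramWithout (X ω) j ^ k) *ᵥ (X ω).col j ∂μ
          + (1 + θ⁻¹) ^ k * ∫ ω, ((X ω).col j ⬝ᵥ (X ω).col j) ^ (k + 1) ∂μ) := by
        rw [integral_finsetSum _ fun j _ => (hquad j).fun_add (hnorm j)]
        simp_rw [integral_add (hquad _) (hnorm _), integral_const_mul]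
    _ ≤ ∑ _j : ι', ((1 + θ) ^ k * (v * ∫ ω, ((X ω * (X ω)ᵀ) ^ k).trace ∂μ)
          + (1 + θ⁻¹) ^ k * ((k + 1).factorial * Real.exp (2 * v * Fintype.card ι))) := by
        refine Finset.sum_le_sum fun j _ => ?_
        gcongr
        · exact (h.integral_dotProduct_gramWithout_pow_le j k).trans
            (mul_le_mul_of_nonneg_left (h.integral_trace_gramWithout_pow_le j k) hv)
        · exact h.integral_dotProduct_col_self_pow_le j (k + 1)
    _ = _ := by rw [Finset.sum_const, Finset.card_univ, nsmul_eq_mul]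

end IsCenteredNoise

lemma inv_pow_mul_factorial_le {θ : ℝ} (hθ : 0 < θ) {j k : ℕ} (hjk : j + 1 ≤ k) :
    (1 + θ⁻¹) ^ j * ((j + 1).factorial : ℝ) ≤ ((1 + θ⁻¹) * k) ^ (j + 1) := by
  have hfactorial : ((j + 1).factorial : ℝ) ≤ (k : ℝ) ^ (j + 1) := by
    exact_mod_cast (Nat.factorial_le_pow (j + 1)).trans (Nat.pow_le_pow_left hjk _)
  have hone : 1 ≤ 1 + θ⁻¹ := le_add_of_nonneg_right (inv_pos.2 hθ).le
  rw [mul_pow]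
  exact mul_le_mul (pow_le_pow_right₀ hone j.le_succ) hfactorial (Nat.cast_nonneg _)
    (by positivity)

namespace IsCenteredNoise

variable [IsProbabilityMeasure μ] [Fintype ι] [Fintype ι'] {θ : ℝ}

section

variable [DecidableEq ι]

lemma integral_trace_gram_pow_le (h : IsCenteredNoise X μ v) (hv : 0 ≤ v) (hθ : 0 < θ)
    {n : ℕ} (hι : Fintype.card ι ≤ n) (hι' : Fintype.card ι' ≤ n) {j k : ℕ} (hjk : j ≤ k) :
    ∫ ω, ((X ω * (X ω)ᵀ) ^ j).trace ∂μ
      ≤ n * Real.exp (2 * v * n) * ((1 + θ) ^ k * (v * n) + (1 + θ⁻¹) * k) ^ j := by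
  have hn : (0 : ℝ) ≤ n := n.cast_nonneg
  have hι : (Fintype.card ι : ℝ) ≤ n := by exact_mod_cast hι
  have hι' : (Fintype.card ι' : ℝ) ≤ n := by exact_mod_cast hι'
  set E := Real.exp (2 * v * n)
  set y := (1 + θ) ^ k * (v * n)
  set z := (1 + θ⁻¹) * (k : ℝ)
  have hy : 0 ≤ y := by positivity
  have hz : 0 ≤ z := by positivity
  have : 0 ≤ E := (Real.exp_pos _).le
  induction j with
  | zero =>
    have hE_one : 1 ≤ E := Real.one_le_exp (by positivity)
    simpa using hι.trans (le_mul_of_one_le_right hn hE_one)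
  | succ j ih =>
    have hmoment : 0 ≤ ∫ ω, ((X ω * (X ω)ᵀ) ^ j).trace ∂μ :=
      integral_nonneg fun ω => ((posSemidef_mul_transpose _).pow j).trace_nonneg
    have hz_pow : (1 + θ⁻¹) ^ j * ((j + 1).factorial : ℝ) ≤ z * (y + z) ^ j :=
      (inv_pow_mul_factorial_le hθ hjk).trans <| by
        rw [pow_succ']
        exact mul_le_mul_of_nonneg_left (pow_le_pow_left₀ hz (by linarith) j) hz
    have hpow : (1 + θ) ^ j ≤ (1 + θ) ^ k := pow_le_pow_right₀ (by linarith) (by omega)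
    calc ∫ ω, ((X ω * (X ω)ᵀ) ^ (j + 1)).trace ∂μ
        ≤ n * ((1 + θ) ^ k * (v * (n * E * (y + z) ^ j)) + z * (y + z) ^ j * E) := by
          refine (h.integral_trace_gram_pow_succ_le hv hθ j).trans ?_
          rw [← mul_assoc ((1 + θ⁻¹) ^ j)]
          have hexp : Real.exp (2 * v * Fintype.card ι) ≤ E :=
            Real.exp_le_exp.2 (mul_le_mul_of_nonneg_left hι (by positivity))
          gcongr
          exact ih (by omega)
      _ = n * E * (y + z) ^ (j + 1) := by ring

lemma measure_trace_gram_pow_gt_le (h : IsCenteredNoise X μ v) (hv : 0 ≤ v) (hθ : 0 < θ)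
    {n : ℕ} (hι : Fintype.card ι ≤ n) (hι' : Fintype.card ι' ≤ n) (k : ℕ) {L : ℝ} (hL : 0 < L) :
    μ {ω | L ^ k < ((X ω * (X ω)ᵀ) ^ k).trace}
      ≤ ENNReal.ofReal
        (n * Real.exp (2 * v * n) * (((1 + θ) ^ k * (v * n) + (1 + θ⁻¹) * k) / L) ^ k) := by
  have hmarkov := mul_meas_ge_le_integral_of_nonneg (μ := μ)
    (f := fun ω => ((X ω * (X ω)ᵀ) ^ k).trace)
    (.of_forall fun ω => ((posSemidef_mul_transpose _).pow k).trace_nonneg)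
    (h.integrable_trace_gram_pow k) (L ^ k)
  calc μ {ω | L ^ k < ((X ω * (X ω)ᵀ) ^ k).trace}
      ≤ μ {ω | L ^ k ≤ ((X ω * (X ω)ᵀ) ^ k).trace} := measure_mono fun ω hω => hω.out.le
    _ = ENNReal.ofReal (μ.real {ω | L ^ k ≤ ((X ω * (X ω)ᵀ) ^ k).trace}) :=
        (ofReal_measureReal).symm
    _ ≤ _ := by
        refine ENNReal.ofReal_le_ofReal ?_
        rw [div_pow, ← mul_div_assoc, le_div_iff₀' (by positivity)]
        exact hmarkov.trans (h.integral_trace_gram_pow_le hv hθ hι hι' le_rfl)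

end

lemma measure_l2_opNorm_gt_le [DecidableEq ι'] (h : IsCenteredNoise X μ v) (hv : 0 ≤ v)
    (hθ : 0 < θ) {n : ℕ} (hι : Fintype.card ι ≤ n) (hι' : Fintype.card ι' ≤ n) {k : ℕ}
    (hk : k ≠ 0) {τ : ℝ} (hτ : 0 < τ) :
    μ {ω | τ < ‖X ω‖}
      ≤ ENNReal.ofReal
        (n * Real.exp (2 * v * n) * (((1 + θ) ^ k * (v * n) + (1 + θ⁻¹) * k) / τ ^ 2) ^ k) := by
  classical
  refine (measure_mono fun ω hω => ?_).trans
    (h.measure_trace_gram_pow_gt_le hv hθ hι hι' k (pow_pos hτ 2))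
  by_contra hle
  exact not_le_of_gt hω.out (l2_opNorm_le_of_trace_pow_le hτ.le hk (not_lt.1 hle))

end IsCenteredNoise

end RandomMatrix

section Asymptotics

open Real

lemma one_add_log_div_pow_le_sqrt {l : ℝ} (hl : 1 ≤ l) {k : ℕ} (hk : k ≤ 2 * l) :
    (1 + log l / (4 * l)) ^ k ≤ √l := by
  have hl0 : 0 < l := by linarith
  have hlog : 0 ≤ log l := log_nonneg hl
  calc (1 + log l / (4 * l)) ^ k ≤ exp (log l / (4 * l)) ^ k :=
        pow_le_pow_left₀ (by positivity) (by linarith [add_one_le_exp (log l / (4 * l))]) _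
    _ = exp (k * (log l / (4 * l))) := (exp_nat_mul _ _).symm
    _ ≤ exp (2 * l * (log l / (4 * l))) :=
        exp_le_exp.2 (mul_le_mul_of_nonneg_right hk (by positivity))
    _ = √l := by
        rw [show 2 * l * (log l / (4 * l)) = log l / 2 by field_simp; ring, ← log_sqrt hl0.le,
          exp_log (sqrt_pos.2 hl0)]

lemma moment_ratio_le {l B η w : ℝ} (hl : 1 < l) (hη : 0 < η) (hw₀ : 0 ≤ w) (hw : w ≤ B * l)
    {k : ℕ} (hk : k ≤ 2 * l) :
    ((1 + log l / (4 * l)) ^ k * w + (1 + (log l / (4 * l))⁻¹) * k) / (η * l) ^ 2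
      ≤ B / η ^ 2 * (√l)⁻¹ + 2 / η ^ 2 * l⁻¹ + 8 / η ^ 2 * (log l)⁻¹ := by
  have hl0 : 0 < l := by linarith
  have hlog : 0 < log l := log_pos hl
  have hsqrt : 0 < √l := sqrt_pos.2 hl0
  have hfirst : (1 + log l / (4 * l)) ^ k * w ≤ √l * (B * l) :=
    mul_le_mul (one_add_log_div_pow_le_sqrt hl.le hk) hw hw₀ hsqrt.le
  have hsecond : (1 + (log l / (4 * l))⁻¹) * k ≤ (1 + (log l / (4 * l))⁻¹) * (2 * l) :=
    mul_le_mul_of_nonneg_left hk (by positivity)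
  have hl_eq : l = √l * √l := (mul_self_sqrt hl0.le).symm
  rw [div_le_iff₀ (by positivity)]
  calc _ ≤ √l * (B * l) + (1 + (log l / (4 * l))⁻¹) * (2 * l) := add_le_add hfirst hsecond
    _ = B * (l * l) * (√l)⁻¹ + 2 * l + 8 * l ^ 2 * (log l)⁻¹ := by
        have hmove : √l * (B * l) = B * (l * l) * (√l)⁻¹ := by
          nth_rewrite 3 [hl_eq]
          field_simp
        rw [hmove]
        field_simp
        ring
    _ = _ := by field_simp

lemma tendsto_moment_rate (B η : ℝ) :
    Tendsto (fun l => B / η ^ 2 * (√l)⁻¹ + 2 / η ^ 2 * l⁻¹ + 8 / η ^ 2 * (log l)⁻¹)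
      atTop (𝓝 0) := by
  have hsqrt := (tendsto_inv_atTop_zero.comp tendsto_sqrt_atTop).const_mul (B / η ^ 2)
  have hinv := (tendsto_inv_atTop_zero (𝕜 := ℝ)).const_mul (2 / η ^ 2)
  have hlog := (tendsto_inv_atTop_zero.comp tendsto_log_atTop).const_mul (8 / η ^ 2)
  simpa using (hsqrt.add hinv).add hlog

lemma tendsto_log_natCast_atTop : Tendsto (fun n : ℕ => log n) atTop atTop :=
  tendsto_log_atTop.comp tendsto_natCast_atTop_atTop

lemma mul_exp_mul_pow_le_rpow {n B c w r : ℝ} (hn : 1 < n) (hB : 0 ≤ B) (hc : 0 ≤ c)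
    (hw : w ≤ B * log n) (hr₀ : 0 ≤ r) (hr : r ≤ exp (-(2 * B + c + 1))) {k : ℕ}
    (hk : log n ≤ k) : n * exp (2 * w) * r ^ k ≤ n ^ (-c) := by
  have hn0 : 0 < n := by linarith
  have : 0 < log n := log_pos hn
  calc n * exp (2 * w) * r ^ k
      ≤ exp (log n) * exp (2 * (B * log n)) * exp (-(2 * B + c + 1)) ^ k := by
        rw [exp_log hn0]
        gcongr
    _ = exp (log n + 2 * (B * log n) + k * -(2 * B + c + 1)) := by
        rw [exp_add, exp_add, exp_nat_mul]
    _ ≤ exp (log n * -c) := exp_le_exp.2 (by nlinarith)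
    _ = n ^ (-c) := (rpow_def_of_pos hn0 _).symm

-- With `k ≈ log n` moments, `θ = log log n / (4 log n)` makes `(1 + θ) ^ k` at most `√(log n)`
-- while `(1 + θ⁻¹) k` stays `o((log n) ^ 2)`.
lemma eventually_exists_moment_parameters {B η c : ℝ} (hB : 0 ≤ B) (hη : 0 < η) (hc : 0 ≤ c) :
    ∀ᶠ n : ℕ in atTop, ∃ (θ : ℝ) (k : ℕ), 0 < θ ∧ k ≠ 0 ∧ ∀ w, 0 ≤ w → w ≤ B * log n →
      n * exp (2 * w) * (((1 + θ) ^ k * w + (1 + θ⁻¹) * k) / (η * log n) ^ 2) ^ k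
        ≤ (n : ℝ) ^ (-c) := by
  filter_upwards [eventually_gt_atTop 1, tendsto_log_natCast_atTop.eventually
    (((tendsto_moment_rate B η).eventually_le_const (exp_pos (-(2 * B + c + 1)))).and
      (eventually_gt_atTop 1))] with n hn ⟨hrate, hl⟩
  have hloglog : 0 < log (log n) := log_pos hl
  have hk : (⌈log n⌉₊ : ℝ) ≤ 2 * log n := by
    linarith [Nat.ceil_lt_add_one (zero_lt_one.trans hl).le]
  refine ⟨log (log n) / (4 * log n), ⌈log n⌉₊, by positivity,
    (Nat.ceil_pos.2 (by linarith)).ne', fun w hw₀ hw => ?_⟩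
  exact mul_exp_mul_pow_le_rpow (by exact_mod_cast hn) hB hc hw (by positivity)
    ((moment_ratio_le hl hη hw₀ hw hk).trans hrate) (Nat.le_ceil _)

lemma eventually_measure_l2_opNorm_gt_le {B η c : ℝ} (hB : 0 ≤ B) (hη : 0 < η) (hc : 0 ≤ c) :
    ∀ᶠ n : ℕ in atTop, ∀ {Ω : Type*} [MeasurableSpace Ω] {μ : Measure Ω} [IsProbabilityMeasure μ]
      {X : Ω → Matrix (Fin n) (Fin n) ℝ} {v : ℝ}, IsCenteredNoise X μ v → 0 ≤ v →
      v * n ≤ B * log n →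
      μ {ω | η * log n < ‖X ω‖} ≤ ENNReal.ofReal ((n : ℝ) ^ (-c)) := by
  filter_upwards [eventually_exists_moment_parameters hB hη hc,
    tendsto_log_natCast_atTop.eventually_gt_atTop 0] with n ⟨θ, k, hθ, hk, hbound⟩ hlog
  intro Ω _ μ _ X v hX hv hvn
  refine (hX.measure_l2_opNorm_gt_le hv hθ (Fintype.card_fin n).le (Fintype.card_fin n).le hk
    (by positivity)).trans (ENNReal.ofReal_le_ofReal ?_)
  rw [mul_assoc 2 v]
  exact hbound _ (by positivity) hvn

end Asymptotics

section FrobeniusInner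

variable {ι ι' ι'' : Type*} [Fintype ι] [Fintype ι'] [Fintype ι'']

/-- The Frobenius inner product of two real matrices, whose associated norm is `frobNorm`. -/
noncomputable def frobInner (X Y : Matrix ι ι' ℝ) : ℝ := (Xᵀ * Y).trace

lemma frobInner_eq_sum (X Y : Matrix ι ι' ℝ) : frobInner X Y = ∑ i, ∑ j, X i j * Y i j := by
  simp only [frobInner, trace, diag_apply, mul_apply, transpose_apply]
  exact Finset.sum_comm

lemma frobInner_eq_sum_dotProduct_col (X Y : Matrix ι ι' ℝ) :
    frobInner X Y = ∑ j, X.col j ⬝ᵥ Y.col j := rfl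

lemma frobInner_comm (X Y : Matrix ι ι' ℝ) : frobInner X Y = frobInner Y X := by
  simp only [frobInner_eq_sum, mul_comm]

lemma frobInner_zero_right (X : Matrix ι ι' ℝ) : frobInner X 0 = 0 := by
  rw [frobInner, Matrix.mul_zero, trace_zero]

lemma frobInner_add_right (X Y Z : Matrix ι ι' ℝ) :
    frobInner X (Y + Z) = frobInner X Y + frobInner X Z := by
  simp only [frobInner, Matrix.mul_add, trace_add]

lemma frobInner_sub_right (X Y Z : Matrix ι ι' ℝ) :
    frobInner X (Y - Z) = frobInner X Y - frobInner X Z := by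
  simp only [frobInner, Matrix.mul_sub, trace_sub]

lemma frobInner_sub_left (X Y Z : Matrix ι ι' ℝ) :
    frobInner (X - Y) Z = frobInner X Z - frobInner Y Z := by
  simp only [frobInner, transpose_sub, Matrix.sub_mul, trace_sub]

lemma frobInner_smul_right (c : ℝ) (X Y : Matrix ι ι' ℝ) :
    frobInner X (c • Y) = c * frobInner X Y := by
  simp only [frobInner, Matrix.mul_smul, trace_smul, smul_eq_mul]

lemma frobInner_neg_right (X Y : Matrix ι ι' ℝ) : frobInner X (-Y) = -frobInner X Y := by
  simp only [frobInner, Matrix.mul_neg, trace_neg]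

lemma frobInner_sum_right {J : Type*} (s : Finset J) (X : Matrix ι ι' ℝ) (Y : J → Matrix ι ι' ℝ) :
    frobInner X (∑ j ∈ s, Y j) = ∑ j ∈ s, frobInner X (Y j) := by
  simp only [frobInner, Matrix.mul_sum, trace_sum]

lemma frobInner_self_nonneg (X : Matrix ι ι' ℝ) : 0 ≤ frobInner X X := by
  rw [frobInner_eq_sum]
  exact Finset.sum_nonneg fun i _ => Finset.sum_nonneg fun j _ => mul_self_nonneg _

lemma frobInner_self_eq_zero {X : Matrix ι ι' ℝ} : frobInner X X = 0 ↔ X = 0 := by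
  rw [frobInner, ← conjTranspose_eq_transpose_of_trivial, trace_conjTranspose_mul_self_eq_zero_iff]

lemma frobInner_transpose (X Y : Matrix ι ι' ℝ) : frobInner Xᵀ Yᵀ = frobInner X Y := by
  rw [frobInner, frobInner, transpose_transpose, ← trace_transpose, transpose_mul,
    transpose_transpose, trace_mul_comm]

lemma frobInner_mul_left (X : Matrix ι ι' ℝ) (Y : Matrix ι ι'' ℝ) (Z : Matrix ι'' ι' ℝ) :
    frobInner X (Y * Z) = frobInner (Yᵀ * X) Z := by
  rw [frobInner, frobInner, transpose_mul, transpose_transpose, Matrix.mul_assoc]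

lemma frobInner_mul_right (X : Matrix ι ι' ℝ) (Y : Matrix ι ι'' ℝ) (Z : Matrix ι'' ι' ℝ) :
    frobInner X (Y * Z) = frobInner (X * Zᵀ) Y := by
  rw [frobInner, frobInner, transpose_mul, transpose_transpose, ← Matrix.mul_assoc,
    trace_mul_comm, ← Matrix.mul_assoc]

lemma frobInner_sub_self (X Y : Matrix ι ι' ℝ) :
    frobInner (X - Y) (X - Y) = frobInner X X + frobInner Y Y - 2 * frobInner X Y := by
  rw [frobInner_sub_left, frobInner_sub_right, frobInner_sub_right, frobInner_comm Y X]
  ring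

lemma frobNorm_eq_sqrt (X : Matrix ι ι' ℝ) : frobNorm X = √(frobInner X X) := by
  rw [frobNorm, frobenius_norm_def, Real.sqrt_eq_rpow, frobInner_eq_sum]
  simp only [Real.norm_eq_abs, Real.rpow_ofNat, sq_abs, ← sq]

lemma frobNorm_sq (X : Matrix ι ι' ℝ) : frobNorm X ^ 2 = frobInner X X := by
  rw [frobNorm_eq_sqrt, Real.sq_sqrt (frobInner_self_nonneg X)]

lemma frobNorm_nonneg (X : Matrix ι ι' ℝ) : 0 ≤ frobNorm X := by
  rw [frobNorm_eq_sqrt]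
  exact Real.sqrt_nonneg _

lemma frobNorm_sub_comm (X Y : Matrix ι ι' ℝ) : frobNorm (X - Y) = frobNorm (Y - X) := by
  rw [frobNorm_eq_sqrt, frobNorm_eq_sqrt, frobInner_sub_self, frobInner_sub_self,
    frobInner_comm X Y, add_comm (frobInner X X)]

lemma frobInner_mul_self_le (X : Matrix ι ι' ℝ) (Y : Matrix ι' ι'' ℝ) :
    frobInner (X * Y) (X * Y) ≤ frobInner X X * frobInner Y Y := by
  have hmul : frobNorm (X * Y) ≤ frobNorm X * frobNorm Y := frobenius_norm_mul X Y
  rw [← frobNorm_sq, ← frobNorm_sq, ← frobNorm_sq, ← mul_pow]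
  exact pow_le_pow_left₀ (frobNorm_nonneg _) hmul 2

lemma abs_frobInner_le (X Y : Matrix ι ι' ℝ) : |frobInner X Y| ≤ frobNorm X * frobNorm Y := by
  refine abs_le_of_sq_le_sq ?_ (mul_nonneg (frobNorm_nonneg X) (frobNorm_nonneg Y))
  rw [mul_pow, frobNorm_sq, frobNorm_sq]
  simpa only [vec_dotProduct_vec, frobInner] using dotProduct_sq_le X.vec Y.vec

lemma frobNorm_mul_le [DecidableEq ι'] (N : Matrix ι ι' ℝ) (Y : Matrix ι' ι'' ℝ) :
    frobNorm (N * Y) ≤ ‖N‖ * frobNorm Y := by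
  refine (sq_le_sq₀ (frobNorm_nonneg _) (mul_nonneg (norm_nonneg N) (frobNorm_nonneg Y))).1 ?_
  rw [mul_pow, frobNorm_sq, frobNorm_sq, frobInner_eq_sum_dotProduct_col,
    frobInner_eq_sum_dotProduct_col, Finset.mul_sum]
  refine Finset.sum_le_sum fun j _ => ?_
  have hcol := pow_le_pow_left₀ (norm_nonneg _) (l2_opNorm_mulVec N (WithLp.toLp 2 (Y.col j))) 2
  rw [mul_pow, EuclideanSpace.norm_sq_eq, EuclideanSpace.norm_sq_eq] at hcol
  simp only [Real.norm_eq_abs, sq_abs] at hcol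
  simp only [dotProduct, ← sq]
  exact hcol

lemma abs_frobInner_mul_le [DecidableEq ι'] (X : Matrix ι ι'' ℝ) (N : Matrix ι ι' ℝ)
    (Y : Matrix ι' ι'' ℝ) : |frobInner X (N * Y)| ≤ ‖N‖ * (frobNorm X * frobNorm Y) :=
  calc |frobInner X (N * Y)| ≤ frobNorm X * frobNorm (N * Y) := abs_frobInner_le X (N * Y)
    _ ≤ frobNorm X * (‖N‖ * frobNorm Y) :=
      mul_le_mul_of_nonneg_left (frobNorm_mul_le N Y) (frobNorm_nonneg X)
    _ = ‖N‖ * (frobNorm X * frobNorm Y) := by ring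

end FrobeniusInner

section Orthogonal

variable {d : ℕ} {U V : Matrix (Fin d) (Fin d) ℝ}

lemma frobInner_one_left (X : Matrix (Fin d) (Fin d) ℝ) : frobInner 1 X = X.trace := by
  rw [frobInner, transpose_one, Matrix.one_mul]

lemma frobInner_orthogonal_self (hU : U ∈ OGroup d) : frobInner U U = d := by
  rw [frobInner, ((mem_OGroup_iff U).1 hU).2, trace_one, Fintype.card_fin]

lemma frobInner_orthogonal_le (hU : U ∈ OGroup d) (hV : V ∈ OGroup d) : frobInner U V ≤ d := by
  have hsub := frobInner_self_nonneg (U - V)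
  rw [frobInner_sub_self, frobInner_orthogonal_self hU, frobInner_orthogonal_self hV] at hsub
  linarith

lemma transpose_mem_OGroup (hU : U ∈ OGroup d) : Uᵀ ∈ OGroup d := by
  rw [mem_OGroup_iff] at hU ⊢
  rw [transpose_transpose]
  exact hU.symm

lemma toMat_mem {κ : GroupKind} (g : groupOf d κ) : toMat g ∈ OGroup d := (g : OGroup d).2

lemma exp_mem_OGroup {B : Matrix (Fin d) (Fin d) ℝ} (hB : Bᵀ = -B) :
    NormedSpace.exp B ∈ OGroup d := by
  have htr : (NormedSpace.exp B)ᵀ = NormedSpace.exp (-B) := by rw [← exp_transpose, hB]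
  rw [mem_OGroup_iff, htr, ← exp_add_of_commute _ _ (Commute.refl B).neg_right,
    ← exp_add_of_commute _ _ (Commute.refl B).neg_left, add_neg_cancel, neg_add_cancel,
    NormedSpace.exp_zero]
  exact ⟨rfl, rfl⟩

lemma hasDerivAt_frobInner_exp (T B : Matrix (Fin d) (Fin d) ℝ) :
    HasDerivAt (fun s : ℝ => frobInner T (NormedSpace.exp (s • B))) (frobInner T B) 0 := by
  let L : Matrix (Fin d) (Fin d) ℝ →ₗ[ℝ] ℝ :=
    { toFun := frobInner T
      map_add' := frobInner_add_right T
      map_smul' := fun c U => frobInner_smul_right c T U }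
  have hexp := hasDerivAt_exp_smul_const (𝕂 := ℝ) B 0
  rw [zero_smul, NormedSpace.exp_zero, Matrix.one_mul] at hexp
  exact (LinearMap.toContinuousLinearMap L).hasFDerivAt.comp_hasDerivAt 0 hexp

-- First-order optimality in the orthogonal Procrustes problem, along the curves `exp (s B)`.
lemma frobInner_eq_zero_of_trace_max {T B : Matrix (Fin d) (Fin d) ℝ}
    (hT : ∀ U ∈ OGroup d, frobInner U T ≤ T.trace) (hB : Bᵀ = -B) : frobInner T B = 0 := by
  refine IsLocalMax.hasDerivAt_eq_zero (Eventually.of_forall fun s => ?_)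
    (hasDerivAt_frobInner_exp T B)
  have hs : (s • B)ᵀ = -(s • B) := by rw [transpose_smul, hB, smul_neg]
  rw [zero_smul, NormedSpace.exp_zero, frobInner_comm T 1, frobInner_one_left, frobInner_comm]
  exact hT _ (exp_mem_OGroup hs)

lemma isSymm_of_trace_max {T : Matrix (Fin d) (Fin d) ℝ}
    (hT : ∀ U ∈ OGroup d, frobInner U T ≤ T.trace) : T.IsSymm := by
  have hskew : (T - Tᵀ)ᵀ = -(T - Tᵀ) := by
    rw [transpose_sub, transpose_transpose, neg_sub]
  have hTB := frobInner_eq_zero_of_trace_max hT hskew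
  have hTB' : frobInner Tᵀ (T - Tᵀ) = 0 := by
    rw [← frobInner_transpose, transpose_transpose, hskew, frobInner_neg_right, hTB, neg_zero]
  have hzero : frobInner (T - Tᵀ) (T - Tᵀ) = 0 := by
    rw [frobInner_sub_left, hTB, hTB', sub_zero]
  exact (sub_eq_zero.1 (frobInner_self_eq_zero.1 hzero)).symm

end Orthogonal

section NuclearNorm

variable {d : ℕ}

lemma exists_orthonormalBasis_norm_eq_singularValues (X : Matrix (Fin d) (Fin d) ℝ) :
    ∃ e : OrthonormalBasis (Fin d) ℝ (EuclideanSpace ℝ (Fin d)),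
      ∀ k, ‖toEuclideanLin X (e k)‖ = (toEuclideanLin X).singularValues k := by
  set T := toEuclideanLin X
  have hd : Module.finrank ℝ (EuclideanSpace ℝ (Fin d)) = d := finrank_euclideanSpace_fin
  let e := T.isSymmetric_adjoint_comp_self.eigenvectorBasis hd
  refine ⟨e, fun k => ?_⟩
  rw [T.singularValues_fin hd k, ← Real.sqrt_sq (norm_nonneg (T (e k)))]
  congr 1
  have heig := T.isSymmetric_adjoint_comp_self.apply_eigenvectorBasis hd k
  rw [← real_inner_self_eq_norm_sq, ← LinearMap.adjoint_inner_left, ← LinearMap.comp_apply, heig,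
    inner_smul_left, real_inner_self_eq_norm_sq, (e.orthonormal.1 k)]
  simp

lemma nuclearNorm_eq_sum (X : Matrix (Fin d) (Fin d) ℝ) :
    nuclearNorm X = ∑ k : Fin d, (toEuclideanLin X).singularValues k := by
  rw [nuclearNorm, Finset.sum_range]

lemma nuclearNorm_nonneg (X : Matrix (Fin d) (Fin d) ℝ) : 0 ≤ nuclearNorm X :=
  Finset.sum_nonneg fun k _ => LinearMap.singularValues_nonneg _ k

lemma norm_toEuclideanLin_orthogonal {U : Matrix (Fin d) (Fin d) ℝ} (hU : U ∈ OGroup d)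
    (v : EuclideanSpace ℝ (Fin d)) : ‖toEuclideanLin U v‖ = ‖v‖ := by
  have hadj : LinearMap.adjoint (toEuclideanLin U) (toEuclideanLin U v) = v := by
    rw [← toEuclideanLin_conjTranspose_eq_adjoint, conjTranspose_eq_transpose_of_trivial,
      ← LinearMap.comp_apply, ← toLpLin_mul_same, ((mem_OGroup_iff U).1 hU).2, toLpLin_one,
      LinearMap.id_apply]
  rw [norm_eq_sqrt_real_inner, ← LinearMap.adjoint_inner_left, hadj, ← norm_eq_sqrt_real_inner]

lemma frobInner_eq_sum_inner {ι : Type*} [Fintype ι] (X Y : Matrix (Fin d) (Fin d) ℝ)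
    (e : OrthonormalBasis ι ℝ (EuclideanSpace ℝ (Fin d))) :
    frobInner X Y = ∑ k, inner ℝ (toEuclideanLin X (e k)) (toEuclideanLin Y (e k)) := by
  have htrace : frobInner X Y =
      LinearMap.trace ℝ _ (LinearMap.adjoint (toEuclideanLin X) ∘ₗ toEuclideanLin Y) := by
    rw [← toEuclideanLin_conjTranspose_eq_adjoint, ← toLpLin_mul_same, toLpLin_eq_toLin,
      trace_toLin_eq, conjTranspose_eq_transpose_of_trivial, frobInner]
  rw [htrace, LinearMap.trace_eq_sum_inner _ e]
  simp only [LinearMap.comp_apply, LinearMap.adjoint_inner_right]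

lemma frobInner_le_nuclearNorm {U : Matrix (Fin d) (Fin d) ℝ} (hU : U ∈ OGroup d)
    (X : Matrix (Fin d) (Fin d) ℝ) : frobInner U X ≤ nuclearNorm X := by
  obtain ⟨e, he⟩ := exists_orthonormalBasis_norm_eq_singularValues X
  rw [frobInner_eq_sum_inner U X e, nuclearNorm_eq_sum]
  refine Finset.sum_le_sum fun k _ => (real_inner_le_norm _ _).trans_eq ?_
  rw [norm_toEuclideanLin_orthogonal hU, he, e.orthonormal.1 k, one_mul]

lemma nuclearNorm_smul_orthogonal {U : Matrix (Fin d) (Fin d) ℝ} (hU : U ∈ OGroup d) {c : ℝ}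
    (hc : 0 ≤ c) : nuclearNorm (c • U) = d * c := by
  obtain ⟨e, he⟩ := exists_orthonormalBasis_norm_eq_singularValues (c • U)
  have hnorm : ∀ k, ‖toEuclideanLin (c • U) (e k)‖ = c := fun k => by
    rw [map_smul, LinearMap.smul_apply, norm_smul, norm_toEuclideanLin_orthogonal hU,
      e.orthonormal.1 k, mul_one, Real.norm_of_nonneg hc]
  simp only [nuclearNorm_eq_sum, ← he, hnorm, Finset.sum_const, Finset.card_univ,
    Fintype.card_fin, nsmul_eq_mul]

end NuclearNorm

section HaarMean

variable {d : ℕ} {κ : GroupKind}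

instance isProbabilityMeasure_unif (d : ℕ) (κ : GroupKind) : IsProbabilityMeasure (unif d κ) :=
  ⟨by
    have hself := Measure.haarMeasure_self (G := groupOf d κ) (K₀ := ⊤)
    rwa [TopologicalSpace.PositiveCompacts.coe_top] at hself⟩

instance isMulLeftInvariant_unif (d : ℕ) (κ : GroupKind) : (unif d κ).IsMulLeftInvariant := by
  unfold unif
  infer_instance

lemma toMat_mul_transpose (g : groupOf d κ) : toMat g * (toMat g)ᵀ = 1 :=
  ((mem_OGroup_iff _).1 (toMat_mem g)).1

lemma toMat_transpose_mul (g : groupOf d κ) : (toMat g)ᵀ * toMat g = 1 :=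
  ((mem_OGroup_iff _).1 (toMat_mem g)).2

lemma toMat_mul (g h : groupOf d κ) : toMat (g * h) = toMat g * toMat h := rfl

lemma measurable_toMat_apply (a b : Fin d) : Measurable fun g : groupOf d κ => toMat g a b :=
  (continuous_toMat.matrix_elem a b).measurable

lemma exists_toMat_eq_diagonal {s : Fin d → ℝ} (hs : ∀ i, s i * s i = 1)
    (hdet : κ = .specialOrthogonal → ∏ i, s i = 1) : ∃ g : groupOf d κ, toMat g = diagonal s := by
  have hO : diagonal s ∈ OGroup d := by
    rw [mem_OGroup_iff, diagonal_transpose, diagonal_mul_diagonal, funext hs, diagonal_one]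
    exact ⟨rfl, rfl⟩
  refine ⟨⟨⟨diagonal s, hO⟩, ?_⟩, rfl⟩
  cases κ with
  | orthogonal => exact Subgroup.mem_top _
  | specialOrthogonal => exact MonoidHom.mem_ker.2 (det_diagonal.trans (hdet rfl))

lemma exists_toMat_eq_diagonal_neg_one_at (h : ¬ (d = 1 ∧ κ = .specialOrthogonal)) (a : Fin d) :
    ∃ s : Fin d → ℝ, s a = -1 ∧ ∃ g : groupOf d κ, toMat g = diagonal s := by
  cases κ with
  | orthogonal =>
    exact ⟨fun _ => -1, rfl, exists_toMat_eq_diagonal (fun _ => by norm_num) nofun⟩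
  | specialOrthogonal =>
    have hd : d ≠ 1 := fun hd => h ⟨hd, rfl⟩
    have : Nontrivial (Fin d) := Fin.nontrivial_iff_two_le.2 (by have := a.pos; omega)
    obtain ⟨b, hb⟩ := exists_ne a
    refine ⟨fun i => if i ∈ ({a, b} : Finset (Fin d)) then -1 else 1, if_pos (by simp),
      exists_toMat_eq_diagonal (fun i => by split_ifs <;> norm_num) fun _ => ?_⟩
    rw [Finset.prod_ite_mem, Finset.univ_inter, Finset.prod_const, Finset.card_pair hb.symm]
    norm_num

/-- The mean of the uniform distribution on the group. -/
noncomputable def meanMat (d : ℕ) (κ : GroupKind) : Matrix (Fin d) (Fin d) ℝ :=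
  Matrix.of fun a b => ∫ g, toMat g a b ∂(unif d κ)

-- Invariance of Haar measure under a group element that flips the sign of the row in question.
lemma meanMat_eq_zero (h : ¬ (d = 1 ∧ κ = .specialOrthogonal)) : meanMat d κ = 0 := by
  ext a b
  obtain ⟨s, hs, g, hg⟩ := exists_toMat_eq_diagonal_neg_one_at h a
  have hflip : ∀ x : groupOf d κ, toMat (g * x) a b = -toMat x a b := fun x => by
    rw [toMat_mul, hg, diagonal_mul, hs, neg_one_mul]
  have hinv := integral_mul_left_eq_self (μ := unif d κ) (fun x => toMat x a b) g
  simp only [hflip, integral_neg] at hinv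
  simp only [meanMat, of_apply, Matrix.zero_apply]
  linarith

lemma toMat_eq_one (g : groupOf 1 .specialOrthogonal) : toMat g = 1 := by
  have hdet : (toMat g).det = 1 := MonoidHom.mem_ker.1 g.2
  rw [det_fin_one] at hdet
  ext i j
  rw [Subsingleton.elim i 0, Subsingleton.elim j 0, hdet, one_apply_eq]

lemma meanMat_eq_one : meanMat 1 .specialOrthogonal = 1 := by
  ext a b
  simp only [meanMat, of_apply, toMat_eq_one, integral_const, probReal_univ, one_smul]

lemma transpose_meanMat (d : ℕ) (κ : GroupKind) : (meanMat d κ)ᵀ = meanMat d κ := by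
  by_cases h : d = 1 ∧ κ = .specialOrthogonal
  · obtain ⟨rfl, rfl⟩ := h
    rw [meanMat_eq_one, transpose_one]
  · rw [meanMat_eq_zero h, transpose_zero]

end HaarMean

section Edge

variable {G : Type*} [MeasurableSpace G] {ν : Measure G} {P : unitInterval} {h : G → ℝ}

/-- The value carried by a random edge: `h` of the sampled label if the edge is present, and `0`
otherwise. -/
def edgeValue (h : G → ℝ) (z : Bool × G) : ℝ := if z.1 = true then h z.2 else 0

/-- The value of a random edge of probability `P`, minus its mean. -/
noncomputable def centredEdge (ν : Measure G) (P : ℝ) (h : G → ℝ) (z : Bool × G) : ℝ :=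
  edgeValue h z - P * ∫ g, h g ∂ν

/-- A function of the label that is constant or has mean zero. Entries of the blocks of the model
are of this kind, which makes their centred edges bounded by `1` rather than by `2`. -/
def IsConstOrCentered (h : G → ℝ) (ν : Measure G) : Prop :=
  (∃ c, ∀ g, h g = c) ∨ ∫ g, h g ∂ν = 0

lemma measurable_edgeValue (hm : Measurable h) : Measurable (edgeValue h) :=
  Measurable.ite (measurable_fst (measurableSet_singleton true)) (hm.comp measurable_snd)
    measurable_const

lemma integral_edgeValue [SFinite ν] :
    ∫ z, edgeValue h z ∂((bernoulliMeasure true false P).prod ν) = P * ∫ g, h g ∂ν := by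
  have hprod : ∀ z, edgeValue h z = (if z.1 = true then 1 else 0) * h z.2 := fun z => by
    simp only [edgeValue, ite_mul, one_mul, zero_mul]
  simp only [hprod]
  rw [integral_prod_mul (fun x : Bool => if x = true then (1 : ℝ) else 0) h,
    integral_bernoulliMeasure]
  simp

variable [IsProbabilityMeasure ν]

lemma abs_centredEdge_le (hb : ∀ g, |h g| ≤ 1) (hc : IsConstOrCentered h ν) (z : Bool × G) :
    |centredEdge ν P h z| ≤ 1 := by
  obtain ⟨hP₀, hP₁⟩ := P.2
  unfold centredEdge edgeValue
  rcases hc with ⟨c, hc⟩ | hc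
  · obtain ⟨hc₁, hc₂⟩ := abs_le.1 (hc z.2 ▸ hb z.2)
    simp only [hc, integral_const, probReal_univ, one_smul]
    split_ifs <;> exact abs_le.2 ⟨by nlinarith, by nlinarith⟩
  · rw [hc, mul_zero, sub_zero]
    split_ifs
    · exact hb z.2
    · simp

lemma integrable_edgeValue (hm : Measurable h) (hb : ∀ g, |h g| ≤ 1) :
    Integrable (edgeValue h) ((bernoulliMeasure true false P).prod ν) := by
  refine .of_bound (measurable_edgeValue hm).aestronglyMeasurable 1 (.of_forall fun z => ?_)
  unfold edgeValue
  split_ifs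
  · exact hb z.2
  · simp

lemma integral_centredEdge (hm : Measurable h) (hb : ∀ g, |h g| ≤ 1) :
    ∫ z, centredEdge ν P h z ∂((bernoulliMeasure true false P).prod ν) = 0 := by
  simp only [centredEdge]
  rw [integral_sub (integrable_edgeValue hm hb) (integrable_const _), integral_edgeValue,
    integral_const, probReal_univ, one_smul, sub_self]

lemma integral_centredEdge_sq_le (hm : Measurable h) (hb : ∀ g, |h g| ≤ 1) :
    ∫ z, centredEdge ν P h z ^ 2 ∂((bernoulliMeasure true false P).prod ν) ≤ P := by
  have hsq : edgeValue h ^ 2 = edgeValue fun g => h g ^ 2 := by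
    ext z
    simp only [edgeValue, Pi.pow_apply, ite_pow, ne_eq, OfNat.ofNat_ne_zero, not_false_eq_true,
      zero_pow]
  have hvar := variance_eq_integral (μ := (bernoulliMeasure true false P).prod ν)
    (measurable_edgeValue hm).aemeasurable
  rw [integral_edgeValue] at hvar
  have hh : ∫ g, h g ^ 2 ∂ν ≤ 1 := by
    simpa using integral_mono_of_nonneg (μ := ν) (.of_forall fun g => sq_nonneg (h g))
      (integrable_const 1) (.of_forall fun g => (sq_le_one_iff_abs_le_one _).2 (hb g))
  calc ∫ z, centredEdge ν P h z ^ 2 ∂((bernoulliMeasure true false P).prod ν)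
      ≤ ∫ z, (edgeValue h ^ 2) z ∂((bernoulliMeasure true false P).prod ν) :=
        hvar.symm.trans_le
          (variance_le_expectation_sq (measurable_edgeValue hm).aestronglyMeasurable)
    _ = P * ∫ g, h g ^ 2 ∂ν := by rw [hsq, integral_edgeValue]
    _ ≤ P := mul_le_of_le_one_right P.2.1 hh

end Edge

section Noise

variable {n K d : ℕ} {κ : GroupKind} {p q : ℝ}

/-- The edge probability of a pair, as a point of the unit interval. -/
noncomputable def edgeProb (p q : ℝ) (C : Fin n → Fin K) (e : Fin n × Fin n) : unitInterval :=
  Set.projIcc (0 : ℝ) 1 zero_le_one (if C e.1 = C e.2 then p else q)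

lemma coe_edgeProb (hp : p ∈ Set.Icc (0 : ℝ) 1) (hq : q ∈ Set.Icc (0 : ℝ) 1) (C : Fin n → Fin K)
    (e : Fin n × Fin n) : (edgeProb p q C e : ℝ) = if C e.1 = C e.2 then p else q := by
  unfold edgeProb
  split_ifs
  · rw [Set.projIcc_of_mem _ hp]
  · rw [Set.projIcc_of_mem _ hq]

/-- An entry of the block of an observed pair, as a function of the uniform group element. -/
noncomputable def edgeEntry (C : Fin n → Fin K) (R : Fin n → groupOf d κ) (a b : Fin d)
    (e : Fin n × Fin n) (g : groupOf d κ) : ℝ :=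
  if C e.1 = C e.2 then (toMat (R e.1) * (toMat (R e.2))ᵀ) a b else toMat g a b

variable (C : Fin n → Fin K) (R : Fin n → groupOf d κ) (a b : Fin d)

lemma measurable_edgeEntry (e : Fin n × Fin n) : Measurable (edgeEntry C R a b e) := by
  unfold edgeEntry
  split_ifs
  · exact measurable_const
  · exact measurable_toMat_apply a b

lemma abs_edgeEntry_le (e : Fin n × Fin n) (g : groupOf d κ) : |edgeEntry C R a b e g| ≤ 1 := by
  unfold edgeEntry
  split_ifs
  · exact entry_norm_bound_of_unitary (𝕜 := ℝ)
      (mul_mem (toMat_mem _) (transpose_mem_OGroup (toMat_mem _))) a b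
  · exact entry_norm_bound_of_unitary (𝕜 := ℝ) (toMat_mem g) a b

lemma isConstOrCentered_edgeEntry (e : Fin n × Fin n) :
    IsConstOrCentered (edgeEntry C R a b e) (unif d κ) := by
  unfold edgeEntry IsConstOrCentered
  split_ifs
  · exact .inl ⟨_, fun _ => rfl⟩
  · by_cases h : d = 1 ∧ κ = .specialOrthogonal
    · obtain ⟨rfl, rfl⟩ := h
      exact .inl ⟨_, fun g => congrFun₂ (toMat_eq_one g) a b⟩
    · exact .inr (congrFun₂ (meanMat_eq_zero h) a b)

/-- The centred `(a, b)` entry of the block of the pair `e`, as a function of the random outcome at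
`e`. It vanishes unless the block lies above the diagonal. -/
noncomputable def edgeNoise (p q : ℝ) (C : Fin n → Fin K) (R : Fin n → groupOf d κ)
    (a b : Fin d) (e : Fin n × Fin n) (z : Bool × groupOf d κ) : ℝ :=
  if e.1 < e.2 then centredEdge (unif d κ) (edgeProb p q C e) (edgeEntry C R a b e) z else 0

/-- The `n × n` matrix of the centred `(a, b)` entries of the blocks above the diagonal. -/
noncomputable def noiseMatrix (p q : ℝ) (C : Fin n → Fin K) (R : Fin n → groupOf d κ)
    (a b : Fin d) (ω : Fin n × Fin n → Bool × groupOf d κ) : Matrix (Fin n) (Fin n) ℝ :=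
  Matrix.of fun i j => edgeNoise p q C R a b (i, j) (ω (i, j))

lemma measurable_edgeNoise (p q : ℝ) (e : Fin n × Fin n) :
    Measurable (edgeNoise p q C R a b e) := by
  unfold edgeNoise
  split_ifs
  · exact (measurable_edgeValue (measurable_edgeEntry C R a b e)).sub_const _
  · exact measurable_const

instance isProbabilityMeasure_sgbmMeasure (d : ℕ) (κ : GroupKind) (p q : ℝ) (C : Fin n → Fin K) :
    IsProbabilityMeasure (sgbmMeasure d κ p q C) := by
  unfold sgbmMeasure
  infer_instance

lemma integral_sgbmMeasure_eval (p q : ℝ) (e : Fin n × Fin n) {F : Bool × groupOf d κ → ℝ}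
    (hF : Measurable F) : ∫ ω, F (ω e) ∂(sgbmMeasure d κ p q C)
      = ∫ z, F z ∂((bernoulliMeasure true false (edgeProb p q C e)).prod (unif d κ)) :=
  integral_comp_eval
    (μ := fun e => (bernoulliMeasure true false (edgeProb p q C e)).prod (unif d κ))
    hF.aestronglyMeasurable

lemma isCenteredNoise_noiseMatrix (hp : p ∈ Set.Icc (0 : ℝ) 1) (hq : q ∈ Set.Icc (0 : ℝ) 1) :
    IsCenteredNoise (noiseMatrix p q C R a b) (sgbmMeasure d κ p q C) (max p q) where
  indep := iIndepFun_pi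
    (μ := fun e => (bernoulliMeasure true false (edgeProb p q C e)).prod (unif d κ))
    (X := edgeNoise p q C R a b) fun e => (measurable_edgeNoise C R a b p q e).aemeasurable
  measurable i j := (measurable_edgeNoise C R a b p q (i, j)).comp (measurable_pi_apply (i, j))
  abs_le_one ω i j := by
    simp only [noiseMatrix, of_apply, edgeNoise]
    split_ifs
    · exact abs_centredEdge_le (abs_edgeEntry_le C R a b _)
        (isConstOrCentered_edgeEntry C R a b _) _
    · simp
  integral_eq_zero i j := by
    refine (integral_sgbmMeasure_eval C p q (i, j) (measurable_edgeNoise C R a b p q (i, j))).trans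
      ?_
    simp only [edgeNoise]
    split_ifs
    · exact integral_centredEdge (measurable_edgeEntry C R a b _) (abs_edgeEntry_le C R a b _)
    · exact integral_zero _ _
  integral_sq_le i j := by
    refine (integral_sgbmMeasure_eval C p q (i, j)
      ((measurable_edgeNoise C R a b p q (i, j)).pow_const 2)).trans_le ?_
    simp only [edgeNoise]
    split_ifs
    · refine (integral_centredEdge_sq_le (measurable_edgeEntry C R a b _)
        (abs_edgeEntry_le C R a b _)).trans ?_
      rw [coe_edgeProb hp hq]
      split_ifs
      exacts [le_max_left p q, le_max_right p q]
    · simpa using Or.inl hp.1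

end Noise

section Observation

variable {n K d : ℕ} {κ : GroupKind} {p q : ℝ}

/-- The mean of the observation, except that the diagonal blocks are `p • 1` instead of `1`. -/
noncomputable def meanObservation (p q : ℝ) (C : Fin n → Fin K) (R : Fin n → groupOf d κ) :
    Matrix (Fin n × Fin d) (Fin n × Fin d) ℝ :=
  Matrix.of fun x y => if C x.1 = C y.1 then p * (toMat (R x.1) * (toMat (R y.1))ᵀ) x.2 y.2
    else q * meanMat d κ x.2 y.2

lemma transpose_meanObservation (p q : ℝ) (C : Fin n → Fin K) (R : Fin n → groupOf d κ) :
    (meanObservation p q C R)ᵀ = meanObservation p q C R := by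
  ext ⟨i, a⟩ ⟨j, b⟩
  have hblock : (toMat (R j) * (toMat (R i))ᵀ) b a = (toMat (R i) * (toMat (R j))ᵀ) a b := by
    rw [← transpose_apply (toMat (R j) * (toMat (R i))ᵀ), transpose_mul, transpose_transpose]
  have hmean : meanMat d κ b a = meanMat d κ a b := congrFun₂ (transpose_meanMat d κ) a b
  simp only [meanObservation, transpose_apply, of_apply, hblock, hmean, eq_comm (a := C j)]

lemma transpose_observation (C : Fin n → Fin K) (R : Fin n → groupOf d κ)
    (ω : Fin n × Fin n → Bool × groupOf d κ) : (observation C R ω)ᵀ = observation C R ω := by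
  ext ⟨i, a⟩ ⟨j, b⟩
  simp only [observation, transpose_apply, of_apply]
  rcases lt_trichotomy i j with hij | rfl | hij
  · simp only [hij, hij.ne, hij.ne', hij.not_gt, if_true, if_false, transpose_apply]
  · simp only [if_true, one_apply, eq_comm]
  · simp only [hij, hij.ne, hij.ne', hij.not_gt, if_true, if_false, transpose_apply]

lemma observation_sub_meanObservation_apply_of_lt (hp : p ∈ Set.Icc (0 : ℝ) 1)
    (hq : q ∈ Set.Icc (0 : ℝ) 1) (C : Fin n → Fin K) (R : Fin n → groupOf d κ)
    (ω : Fin n × Fin n → Bool × groupOf d κ) {i j : Fin n} (hij : i < j) (a b : Fin d) :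
    (observation C R ω - meanObservation p q C R) (i, a) (j, b)
      = noiseMatrix p q C R a b ω i j := by
  simp only [observation, meanObservation, Matrix.sub_apply, of_apply, hij.ne, hij, if_true,
    if_false, noiseMatrix, edgeNoise, centredEdge, edgeValue, coe_edgeProb hp hq, upperBlock,
    edgeEntry]
  by_cases hC : C i = C j <;> by_cases hb : (ω (i, j)).1 = true <;> simp [hC, hb, meanMat]

lemma noiseMatrix_apply_of_not_lt (C : Fin n → Fin K) (R : Fin n → groupOf d κ)
    (ω : Fin n × Fin n → Bool × groupOf d κ) {i j : Fin n} (hij : ¬ i < j) (a b : Fin d) :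
    noiseMatrix p q C R a b ω i j = 0 := by
  simp only [noiseMatrix, of_apply, edgeNoise, hij, if_false]

lemma observation_sub_meanObservation_apply (hp : p ∈ Set.Icc (0 : ℝ) 1)
    (hq : q ∈ Set.Icc (0 : ℝ) 1) (C : Fin n → Fin K) (R : Fin n → groupOf d κ)
    (ω : Fin n × Fin n → Bool × groupOf d κ) (i j : Fin n) (a b : Fin d) :
    (observation C R ω - meanObservation p q C R) (i, a) (j, b)
      = (1 - p) * (1 : Matrix (Fin n × Fin d) (Fin n × Fin d) ℝ) (i, a) (j, b)
        + (noiseMatrix p q C R a b ω i j + noiseMatrix p q C R b a ω j i) := by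
  rcases lt_trichotomy i j with hij | rfl | hij
  · rw [observation_sub_meanObservation_apply_of_lt hp hq C R ω hij,
      noiseMatrix_apply_of_not_lt C R ω hij.not_gt, one_apply_ne (by simp [hij.ne])]
    ring
  · rw [noiseMatrix_apply_of_not_lt C R ω (lt_irrefl i),
      noiseMatrix_apply_of_not_lt C R ω (lt_irrefl i)]
    simp only [observation, meanObservation, Matrix.sub_apply, of_apply, if_true,
      toMat_mul_transpose, one_apply, Prod.mk.injEq, true_and]
    ring
  · rw [← transpose_apply (observation C R ω - meanObservation p q C R), transpose_sub,
      transpose_observation, transpose_meanObservation,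
      observation_sub_meanObservation_apply_of_lt hp hq C R ω hij,
      noiseMatrix_apply_of_not_lt C R ω hij.not_gt, one_apply_ne (by simp [hij.ne'])]
    ring

open scoped Kronecker

lemma observation_sub_meanObservation (hp : p ∈ Set.Icc (0 : ℝ) 1) (hq : q ∈ Set.Icc (0 : ℝ) 1)
    (C : Fin n → Fin K) (R : Fin n → groupOf d κ) (ω : Fin n × Fin n → Bool × groupOf d κ) :
    observation C R ω - meanObservation p q C R = (1 - p) • 1 + ∑ a, ∑ b,
      (noiseMatrix p q C R a b ω ⊗ₖ single a b 1
        + (noiseMatrix p q C R a b ω ⊗ₖ single a b 1)ᵀ) := by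
  ext ⟨i, a⟩ ⟨j, b⟩
  rw [observation_sub_meanObservation_apply hp hq C R ω]
  simp [Matrix.sum_apply, single_apply, Finset.sum_add_distrib, ite_and]

lemma l2_opNorm_kronecker_single_le {ι ι' J J' : Type*} [Fintype ι] [Fintype ι'] [Fintype J]
    [Fintype J'] [DecidableEq ι'] [DecidableEq J] [DecidableEq J'] (N : Matrix ι ι' ℝ) (a : J)
    (b : J') : ‖N ⊗ₖ single a b (1 : ℝ)‖ ≤ ‖N‖ := by
  rw [l2_opNorm_def]
  refine ContinuousLinearMap.opNorm_le_bound _ (norm_nonneg N) fun v => ?_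
  let w : EuclideanSpace ℝ ι' := WithLp.toLp 2 fun j => v (j, b)
  have happly : ∀ i a', ((N ⊗ₖ single a b (1 : ℝ)) *ᵥ v.ofLp) (i, a')
      = if a' = a then (N *ᵥ w.ofLp) i else 0 := fun i a' => by
    simp [mulVec, dotProduct, Fintype.sum_prod_type, single_apply, w, ite_and, eq_comm (a := a)]
  have hnorm : ‖WithLp.toLp 2 ((N ⊗ₖ single a b (1 : ℝ)) *ᵥ v.ofLp)‖
      = ‖WithLp.toLp 2 (N *ᵥ w.ofLp)‖ := by
    simp [EuclideanSpace.norm_eq, Fintype.sum_prod_type, happly, ite_pow, apply_ite]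
  have hw : ‖w‖ ≤ ‖v‖ := by
    simp only [EuclideanSpace.norm_eq, Fintype.sum_prod_type]
    exact Real.sqrt_le_sqrt (Finset.sum_le_sum fun j _ =>
      Finset.single_le_sum (f := fun b => ‖v (j, b)‖ ^ 2) (fun _ _ => sq_nonneg _)
        (Finset.mem_univ b))
  calc ‖WithLp.toLp 2 ((N ⊗ₖ single a b (1 : ℝ)) *ᵥ v.ofLp)‖
      = ‖WithLp.toLp 2 (N *ᵥ w.ofLp)‖ := hnorm
    _ ≤ ‖N‖ * ‖w‖ := l2_opNorm_mulVec N w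
    _ ≤ ‖N‖ * ‖v‖ := mul_le_mul_of_nonneg_left hw (norm_nonneg N)

lemma norm_observation_sub_meanObservation_le (hp : p ∈ Set.Icc (0 : ℝ) 1)
    (hq : q ∈ Set.Icc (0 : ℝ) 1) (C : Fin n → Fin K) (R : Fin n → groupOf d κ)
    (ω : Fin n × Fin n → Bool × groupOf d κ) {τ : ℝ} (h : ∀ a b, ‖noiseMatrix p q C R a b ω‖ ≤ τ) :
    ‖observation C R ω - meanObservation p q C R‖ ≤ 1 + 2 * d ^ 2 * τ := by
  have hone : ‖(1 - p) • (1 : Matrix (Fin n × Fin d) (Fin n × Fin d) ℝ)‖ ≤ 1 := by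
    rw [smul_one_eq_diagonal, l2_opNorm_diagonal]
    refine (pi_norm_const_le _).trans (abs_le.2 ⟨?_, ?_⟩) <;> linarith [hp.1, hp.2]
  have hnoise : ∀ a b, ‖noiseMatrix p q C R a b ω ⊗ₖ single a b 1
      + (noiseMatrix p q C R a b ω ⊗ₖ single a b 1)ᵀ‖ ≤ 2 * τ := fun a b => by
    have hle := (l2_opNorm_kronecker_single_le (noiseMatrix p q C R a b ω) a b).trans (h a b)
    refine (norm_add_le _ _).trans ?_
    rw [← conjTranspose_eq_transpose_of_trivial, l2_opNorm_conjTranspose]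
    linarith
  have hsum := norm_sum_le_of_le Finset.univ fun a _ =>
    norm_sum_le_of_le Finset.univ fun b _ => hnoise a b
  rw [observation_sub_meanObservation hp hq]
  refine (norm_add_le _ _).trans (add_le_add hone (hsum.trans_eq ?_))
  simp only [Finset.sum_const, Finset.card_univ, Fintype.card_fin, nsmul_eq_mul]
  ring

end Observation

section Blocks

variable {n l K d : ℕ} {κ κ' : GroupKind}

lemma block_mul (A : Matrix (Fin n × Fin d) (Fin l × Fin d) ℝ)
    (X : Matrix (Fin l × Fin d) (Fin K × Fin d) ℝ) (i : Fin n) (k : Fin K) :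
    block (A * X) i k = ∑ j, block A i j * block X j k := by
  ext a b
  simp only [block, of_apply, mul_apply, Matrix.sum_apply, Fintype.sum_prod_type]

lemma block_add (X Y : Matrix (Fin n × Fin d) (Fin K × Fin d) ℝ) (i : Fin n) (k : Fin K) :
    block (X + Y) i k = block X i k + block Y i k := rfl

lemma block_sub (X Y : Matrix (Fin n × Fin d) (Fin K × Fin d) ℝ) (i : Fin n) (k : Fin K) :
    block (X - Y) i k = block X i k - block Y i k := rfl

lemma block_smul (c : ℝ) (X : Matrix (Fin n × Fin d) (Fin K × Fin d) ℝ) (i : Fin n)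
    (k : Fin K) : block (c • X) i k = c • block X i k := rfl

lemma block_transpose (X : Matrix (Fin n × Fin d) (Fin K × Fin d) ℝ) (k : Fin K) (i : Fin n) :
    block Xᵀ k i = (block X i k)ᵀ := rfl

lemma frobInner_eq_sum_block (X Y : Matrix (Fin n × Fin d) (Fin K × Fin d) ℝ) :
    frobInner X Y = ∑ i, ∑ k, frobInner (block X i k) (block Y i k) := by
  simp only [frobInner_eq_sum, block, of_apply, Fintype.sum_prod_type]
  exact Finset.sum_congr rfl fun i _ => Finset.sum_comm

lemma block_assemble (C : Fin n → Fin K) (R : Fin n → groupOf d κ) (i : Fin n) (k : Fin K) :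
    block (assemble C R) i k = if C i = k then toMat (R i) else 0 := by
  ext a b
  simp only [block, assemble, of_apply]
  split_ifs <;> rfl

lemma block_assemble_self (C : Fin n → Fin K) (R : Fin n → groupOf d κ) (i : Fin n) :
    block (assemble C R) i (C i) = toMat (R i) := by
  rw [block_assemble, if_pos rfl]

lemma block_assemble_of_ne (C : Fin n → Fin K) (R : Fin n → groupOf d κ) {i : Fin n} {k : Fin K}
    (h : C i ≠ k) : block (assemble C R) i k = 0 := by
  rw [block_assemble, if_neg h]

lemma block_assemble_mul (C : Fin n → Fin K) (R : Fin n → groupOf d κ)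
    (Z : Matrix (Fin K × Fin d) (Fin l × Fin d) ℝ) (i : Fin n) (k : Fin l) :
    block (assemble C R * Z) i k = toMat (R i) * block Z (C i) k := by
  rw [block_mul, Finset.sum_eq_single (C i), block_assemble_self]
  · intro k' _ hk'
    rw [block_assemble_of_ne C R hk'.symm, Matrix.zero_mul]
  · simp

lemma block_transpose_assemble_mul (C : Fin n → Fin K) (R : Fin n → groupOf d κ)
    (X : Matrix (Fin n × Fin d) (Fin l × Fin d) ℝ) (k : Fin K) (k' : Fin l) :
    block ((assemble C R)ᵀ * X) k k' = ∑ j with C j = k, (toMat (R j))ᵀ * block X j k' := by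
  rw [block_mul, Finset.sum_filter]
  refine Finset.sum_congr rfl fun j _ => ?_
  rw [block_transpose, block_assemble]
  split_ifs
  · rfl
  · rw [transpose_zero, Matrix.zero_mul]

lemma frobInner_assemble (C : Fin n → Fin K) (R : Fin n → groupOf d κ)
    (X : Matrix (Fin n × Fin d) (Fin K × Fin d) ℝ) :
    frobInner (assemble C R) X = ∑ i, frobInner (toMat (R i)) (block X i (C i)) := by
  rw [frobInner_eq_sum_block]
  refine Finset.sum_congr rfl fun i _ => ?_
  rw [Finset.sum_eq_single (C i), block_assemble_self]
  · intro k _ hk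
    rw [block_assemble_of_ne C R hk.symm, frobInner_comm, frobInner_zero_right]
  · simp

lemma frobInner_assemble_self (C : Fin n → Fin K) (R : Fin n → groupOf d κ) :
    frobInner (assemble C R) (assemble C R) = n * d := by
  simp only [frobInner_assemble, block_assemble_self, frobInner_orthogonal_self (toMat_mem _),
    Finset.sum_const, Finset.card_univ, Fintype.card_fin, nsmul_eq_mul]

/-- The contribution of the block row `i` to `‖assemble C R - assemble c O‖²`, see
`frobInner_assemble_sub_self`. -/
noncomputable def rowDist (C c : Fin n → Fin K) (R : Fin n → groupOf d κ)
    (O : Fin n → groupOf d κ') (i : Fin n) : ℝ :=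
  if c i = C i then frobInner (toMat (R i) - toMat (O i)) (toMat (R i) - toMat (O i)) else 2 * d

lemma rowDist_nonneg (C c : Fin n → Fin K) (R : Fin n → groupOf d κ) (O : Fin n → groupOf d κ')
    (i : Fin n) : 0 ≤ rowDist C c R O i := by
  unfold rowDist
  split_ifs
  · exact frobInner_self_nonneg _
  · positivity

lemma rowDist_eq (C c : Fin n → Fin K) (R : Fin n → groupOf d κ) (O : Fin n → groupOf d κ')
    (i : Fin n) :
    rowDist C c R O i =
      2 * (d - frobInner (toMat (R i)) (block (assemble c O) i (C i))) := by
  rw [rowDist, block_assemble]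
  split_ifs
  · rw [frobInner_sub_self, frobInner_orthogonal_self (toMat_mem _),
      frobInner_orthogonal_self (toMat_mem _)]
    ring
  · rw [frobInner_zero_right, sub_zero]

lemma frobInner_assemble_sub_self (C c : Fin n → Fin K) (R : Fin n → groupOf d κ)
    (O : Fin n → groupOf d κ') :
    frobInner (assemble C R - assemble c O) (assemble C R - assemble c O)
      = ∑ i, rowDist C c R O i := by
  simp only [rowDist_eq, ← Finset.mul_sum, Finset.sum_sub_distrib, ← frobInner_assemble,
    Finset.sum_const, Finset.card_univ, Fintype.card_fin, nsmul_eq_mul]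
  rw [frobInner_sub_self, frobInner_assemble_self, frobInner_assemble_self]
  ring

end Blocks

section Contraction

variable {n K d : ℕ} {κ κ' : GroupKind}

/-- The block matrix `X` separates the truth `assemble C R` at level `s`: its blocks on the
support of the truth are the multiples `g i` of the true orthogonal matrices, and rounding any
other block of the row `i` to an orthogonal matrix gains less by at least `s`. -/
structure IsSeparated (X : Matrix (Fin n × Fin d) (Fin K × Fin d) ℝ) (C : Fin n → Fin K)
    (R : Fin n → groupOf d κ) (g : Fin n → ℝ) (s : ℝ) : Prop where
  pos : 0 < s
  le_mul : ∀ i, s ≤ d * g i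
  block_eq : ∀ i, block X i (C i) = g i • toMat (R i)
  le_sub : ∀ i k, k ≠ C i → ∀ U ∈ OGroup d, s ≤ d * g i - frobInner U (block X i k)

/-- Adding `Y` to an update changes the advantage of the truth `assemble C R` over another cluster
by at most `δ`, and its advantage over another rotation `U` by at most half of `δ ‖R i - U‖²`. -/
structure IsSmallPerturbation (Y : Matrix (Fin n × Fin d) (Fin K × Fin d) ℝ) (C : Fin n → Fin K)
    (R : Fin n → groupOf d κ) (δ : ℝ) : Prop where
  neg_le_sub : ∀ i k, k ≠ C i → ∀ U ∈ OGroup d,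
    -δ ≤ frobInner (toMat (R i)) (block Y i (C i)) - frobInner U (block Y i k)
  neg_le_rotation : ∀ i, ∀ U ∈ OGroup d,
    -(δ / 2) * frobInner (toMat (R i) - U) (toMat (R i) - U)
      ≤ frobInner (toMat (R i) - U) (block Y i (C i))

lemma IsSmallPerturbation.mono {Y : Matrix (Fin n × Fin d) (Fin K × Fin d) ℝ}
    {C : Fin n → Fin K} {R : Fin n → groupOf d κ} {δ δ' : ℝ} (h : IsSmallPerturbation Y C R δ)
    (hδ : δ ≤ δ') : IsSmallPerturbation Y C R δ' where
  neg_le_sub i k hk U hU := (neg_le_neg hδ).trans (h.neg_le_sub i k hk U hU)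
  neg_le_rotation i U hU := by
    have hdist := frobInner_self_nonneg (toMat (R i) - U)
    exact (mul_le_mul_of_nonneg_right (by linarith) hdist).trans (h.neg_le_rotation i U hU)

namespace IsSeparated

variable {X Y : Matrix (Fin n × Fin d) (Fin K × Fin d) ℝ} {C : Fin n → Fin K}
  {R : Fin n → groupOf d κ} {g : Fin n → ℝ} {s δ : ℝ}

lemma frobInner_block (hX : IsSeparated X C R g s) (i : Fin n) :
    frobInner (toMat (R i)) (block X i (C i)) = d * g i := by
  rw [hX.block_eq, frobInner_smul_right, frobInner_orthogonal_self (toMat_mem _), mul_comm]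

lemma le_frobInner_rotation (hd : 1 ≤ d) (hX : IsSeparated X C R g s)
    (hY : IsSmallPerturbation Y C R δ) (hδ : 2 * d * δ ≤ s) (i : Fin n)
    {U : Matrix (Fin d) (Fin d) ℝ} (hU : U ∈ OGroup d) :
    s / (4 * d) * frobInner (toMat (R i) - U) (toMat (R i) - U)
      ≤ frobInner (toMat (R i) - U) (block (X + Y) i (C i)) := by
  have : (0 : ℝ) < d := by exact_mod_cast hd
  set F := frobInner (toMat (R i) - U) (toMat (R i) - U) with hF
  have hdist : F = 2 * (d - frobInner U (toMat (R i))) := by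
    rw [hF, frobInner_sub_self, frobInner_orthogonal_self (toMat_mem _),
      frobInner_orthogonal_self hU, frobInner_comm (toMat (R i))]
    ring
  have hgain : frobInner (toMat (R i) - U) (block X i (C i)) = g i / 2 * F := by
    rw [frobInner_sub_left, hX.frobInner_block, hX.block_eq, frobInner_smul_right, hdist]
    ring
  have hcoeff : s / (4 * d) ≤ g i / 2 - δ / 2 := by
    rw [div_le_iff₀ (by positivity)]
    linarith [hX.le_mul i]
  have hmul := mul_le_mul_of_nonneg_right hcoeff (frobInner_self_nonneg (toMat (R i) - U))
  rw [block_add, frobInner_add_right, hgain]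
  linarith [hY.neg_le_rotation i U hU]

lemma le_frobInner_sub_of_ne (hd : 1 ≤ d) (hX : IsSeparated X C R g s)
    (hY : IsSmallPerturbation Y C R δ) (hδ : 2 * d * δ ≤ s) {i : Fin n} {k : Fin K}
    (hk : k ≠ C i) {U : Matrix (Fin d) (Fin d) ℝ} (hU : U ∈ OGroup d) :
    s / 2 ≤ frobInner (toMat (R i)) (block (X + Y) i (C i)) - frobInner U (block (X + Y) i k) := by
  have hd1 : (1 : ℝ) ≤ d := by exact_mod_cast hd
  have hδs : δ ≤ s / 2 := by nlinarith [hX.pos]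
  rw [block_add, block_add, frobInner_add_right, frobInner_add_right, hX.frobInner_block]
  linarith [hX.le_sub i k hk U hU, hY.neg_le_sub i k hk U hU]

lemma mul_frobInner_sub_le (hd : 1 ≤ d) (hX : IsSeparated X C R g s)
    (hY : IsSmallPerturbation Y C R δ) (hδ : 2 * d * δ ≤ s) (c : Fin n → Fin K)
    (O : Fin n → groupOf d κ') :
    s / (4 * d) * frobInner (assemble C R - assemble c O) (assemble C R - assemble c O)
      ≤ frobInner (assemble C R - assemble c O) (X + Y) := by
  rw [frobInner_assemble_sub_self, Finset.mul_sum, frobInner_sub_left, frobInner_assemble,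
    frobInner_assemble, ← Finset.sum_sub_distrib]
  refine Finset.sum_le_sum fun i _ => ?_
  unfold rowDist
  split_ifs with hc
  · rw [hc, ← frobInner_sub_left]
    exact hX.le_frobInner_rotation hd hY hδ i (toMat_mem (O i))
  · have : (0 : ℝ) < d := by exact_mod_cast hd
    have hlevel : s / (4 * d) * (2 * d) = s / 2 := by field_simp; ring
    rw [hlevel]
    exact hX.le_frobInner_sub_of_ne hd hY hδ hc (toMat_mem (O i))

lemma mul_frobNorm_sub_le {A M : Matrix (Fin n × Fin d) (Fin n × Fin d) ℝ}
    {W : Matrix (Fin n × Fin d) (Fin K × Fin d) ℝ} (hd : 1 ≤ d)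
    (hX : IsSeparated (A * assemble C R) C R g s)
    (hY : IsSmallPerturbation (M * (W - assemble C R)) C R δ) (hδ : 2 * d * δ ≤ s)
    {c : Fin n → Fin K} {O : Fin n → groupOf d κ'}
    (hopt : frobInner (assemble C R) (A * W) ≤ frobInner (assemble c O) (A * W)) :
    s / (4 * d) * frobNorm (assemble C R - assemble c O)
      ≤ ‖A - M‖ * frobNorm (W - assemble C R) := by
  set V := assemble C R
  have hupdate : A * W = A * V + M * (W - V) + (A - M) * (W - V) := by
    rw [add_assoc, ← Matrix.add_mul, add_sub_cancel, ← Matrix.mul_add, add_sub_cancel]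
  have hnoise := (abs_le.1 (abs_frobInner_mul_le (V - assemble c O) (A - M) (W - V))).1
  have hgain : frobInner (V - assemble c O) (A * W) ≤ 0 := by
    rw [frobInner_sub_left]
    linarith
  rw [hupdate, frobInner_add_right] at hgain
  have hsq := hX.mul_frobInner_sub_le hd hY hδ c O
  rw [← frobNorm_sq] at hsq
  rcases (frobNorm_nonneg (V - assemble c O)).eq_or_lt with hzero | hpos
  · rw [← hzero, mul_zero]
    exact mul_nonneg (norm_nonneg _) (frobNorm_nonneg _)
  · refine le_of_mul_le_mul_left ?_ hpos
    linarith

end IsSeparated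

end Contraction

section MeanPart

variable {n K d : ℕ} {κ κ' : GroupKind} {C c : Fin n → Fin K} {R : Fin n → groupOf d κ}
  {O : Fin n → groupOf d κ'}

lemma frobInner_one_sub {Z S : Matrix (Fin d) (Fin d) ℝ} (hZ : Z ∈ OGroup d) (hS : S.IsSymm) :
    frobInner (1 - Z) S = frobInner (1 - Z) ((1 - Z) * S) / 2 := by
  have htranspose : frobInner (1 - Z)ᵀ S = frobInner (1 - Z) S := by
    rw [← frobInner_transpose, transpose_transpose, hS.eq]
  have hgram : (1 - Z)ᵀ * (1 - Z) = (1 - Z) + (1 - Z)ᵀ := by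
    rw [transpose_sub, transpose_one, Matrix.sub_mul, Matrix.mul_sub, Matrix.mul_sub,
      ((mem_OGroup_iff Z).1 hZ).2]
    simp only [Matrix.one_mul, Matrix.mul_one]
    abel
  have hsum : frobInner (1 - Z) ((1 - Z) * S) = frobInner (1 - Z) S + frobInner (1 - Z)ᵀ S := by
    rw [frobInner_mul_left, hgram, frobInner_comm, frobInner_add_right, frobInner_comm S,
      frobInner_comm S]
  rw [hsum, htranspose, add_self_div_two]

lemma frobInner_mul_one_sub_le (E : Matrix (Fin d) (Fin d) ℝ) {Z : Matrix (Fin d) (Fin d) ℝ}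
    (hZ : Z ∈ OGroup d) :
    frobInner E (E * (1 - Z)) ≤ frobInner E E * frobInner (1 - Z) (1 - Z) / 2 := by
  have hsymm : (Eᵀ * E).IsSymm := isSymm_transpose_mul_self E
  have hmul := frobInner_mul_self_le (1 - Z) Eᵀ
  rw [frobInner_transpose] at hmul
  rw [frobInner_mul_left, frobInner_comm, frobInner_one_sub hZ hsymm, ← Matrix.mul_assoc,
    frobInner_mul_right]
  linarith

lemma neg_rowDist_le (j : Fin n) {k : Fin K} (hk : k ≠ C j) {U : Matrix (Fin d) (Fin d) ℝ}
    (hU : U ∈ OGroup d) :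
    -rowDist C c R O j ≤ frobInner (toMat (R j)) (block (assemble c O - assemble C R) j (C j))
      - frobInner U (block (assemble c O - assemble C R) j k) := by
  rw [block_sub, block_sub, block_assemble_self, block_assemble_of_ne C R hk.symm, sub_zero,
    frobInner_sub_right, frobInner_orthogonal_self (toMat_mem _), rowDist_eq]
  by_cases hc : c j = C j
  · rw [← hc, block_assemble_self, block_assemble_of_ne c O (hc ▸ hk.symm), frobInner_zero_right]
    linarith [frobInner_orthogonal_le (toMat_mem (R j)) (toMat_mem (O j))]
  · rw [block_assemble_of_ne c O hc, frobInner_zero_right, block_assemble]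
    have : (0 : ℝ) ≤ d := Nat.cast_nonneg d
    split_ifs
    · linarith [frobInner_orthogonal_le hU (toMat_mem (O j))]
    · rw [frobInner_zero_right]
      linarith

lemma neg_frobInner_mul_block_le_rowDist (hd : 1 ≤ d) (j : Fin n)
    (E : Matrix (Fin d) (Fin d) ℝ) :
    -frobInner E (E * ((toMat (R j))ᵀ * block (assemble c O - assemble C R) j (C j)))
      ≤ frobInner E E * rowDist C c R O j := by
  rw [block_sub, block_assemble_self, ← frobInner_neg_right, ← Matrix.mul_neg, ← Matrix.mul_neg,
    neg_sub, Matrix.mul_sub, toMat_transpose_mul, rowDist, block_assemble]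
  have hE := frobInner_self_nonneg E
  split_ifs
  · have hRO := mul_mem (transpose_mem_OGroup (toMat_mem (R j))) (toMat_mem (O j))
    have hdist : frobInner (1 - (toMat (R j))ᵀ * toMat (O j)) (1 - (toMat (R j))ᵀ * toMat (O j))
        = frobInner (toMat (R j) - toMat (O j)) (toMat (R j) - toMat (O j)) := by
      simp only [frobInner_sub_self, frobInner_orthogonal_self hRO,
        frobInner_orthogonal_self (toMat_mem _), frobInner_orthogonal_self (one_mem (OGroup d)),
        frobInner_mul_left, transpose_transpose, Matrix.mul_one]
    have hmul := frobInner_mul_one_sub_le E hRO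
    rw [hdist] at hmul
    linarith [mul_nonneg hE (frobInner_self_nonneg (toMat (R j) - toMat (O j)))]
  · have hd1 : (1 : ℝ) ≤ d := by exact_mod_cast hd
    rw [Matrix.mul_zero, sub_zero, Matrix.mul_one]
    nlinarith

lemma block_smul_assemble_mul (p : ℝ) (X : Matrix (Fin n × Fin d) (Fin K × Fin d) ℝ) (i : Fin n)
    (k : Fin K) :
    block (p • (assemble C R * (assemble C R)ᵀ) * X) i k
      = p • (toMat (R i) * block ((assemble C R)ᵀ * X) (C i) k) := by
  rw [Matrix.smul_mul, block_smul, Matrix.mul_assoc, block_assemble_mul]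

lemma sum_filter_rowDist_le (k : Fin K) :
    ∑ j with C j = k, rowDist C c R O j
      ≤ frobInner (assemble C R - assemble c O) (assemble C R - assemble c O) := by
  rw [frobInner_assemble_sub_self]
  exact Finset.sum_le_sum_of_subset_of_nonneg (Finset.filter_subset _ _)
    fun j _ _ => rowDist_nonneg C c R O j

lemma neg_frobInner_sub_self_le {k k' : Fin K} (hk : k' ≠ k) {U : Matrix (Fin d) (Fin d) ℝ}
    (hU : U ∈ OGroup d) :
    -frobInner (assemble C R - assemble c O) (assemble C R - assemble c O)
      ≤ (block ((assemble C R)ᵀ * (assemble c O - assemble C R)) k k).trace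
        - frobInner U (block ((assemble C R)ᵀ * (assemble c O - assemble C R)) k k') := by
  refine (neg_le_neg (sum_filter_rowDist_le k)).trans ?_
  rw [block_transpose_assemble_mul, block_transpose_assemble_mul, trace_sum,
    frobInner_sum_right, ← Finset.sum_sub_distrib, ← Finset.sum_neg_distrib]
  refine Finset.sum_le_sum fun j hj => ?_
  obtain rfl : C j = k := (Finset.mem_filter.1 hj).2
  rw [frobInner_mul_left, transpose_transpose]
  exact neg_rowDist_le j hk (mul_mem (toMat_mem (R j)) hU)

lemma neg_frobInner_mul_block_le (hd : 1 ≤ d) (k : Fin K) (E : Matrix (Fin d) (Fin d) ℝ) :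
    -frobInner E (E * block ((assemble C R)ᵀ * (assemble c O - assemble C R)) k k)
      ≤ frobInner E E
        * frobInner (assemble C R - assemble c O) (assemble C R - assemble c O) := by
  refine le_trans ?_
    (mul_le_mul_of_nonneg_left (sum_filter_rowDist_le k) (frobInner_self_nonneg E))
  rw [block_transpose_assemble_mul, Matrix.mul_sum, frobInner_sum_right, Finset.mul_sum,
    ← Finset.sum_neg_distrib]
  refine Finset.sum_le_sum fun j hj => ?_
  obtain rfl : C j = k := (Finset.mem_filter.1 hj).2
  exact neg_frobInner_mul_block_le_rowDist hd j E

lemma isSymm_block_transpose_mul_sub {V W : Matrix (Fin n × Fin d) (Fin K × Fin d) ℝ}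
    {k : Fin K} (h : (block (Vᵀ * W) k k).IsSymm) : (block (Vᵀ * (W - V)) k k).IsSymm := by
  rw [Matrix.mul_sub, block_sub]
  refine h.sub ?_
  rw [IsSymm, ← block_transpose, transpose_mul, transpose_transpose]

-- `p V Vᵀ` is the mean of the observation when the uniform distribution on the group is centred.
lemma isSmallPerturbation_smul_mul_transpose (hd : 1 ≤ d) {p : ℝ} (hp : 0 ≤ p)
    (hsymm : ∀ k, (block ((assemble C R)ᵀ * assemble c O) k k).IsSymm) :
    IsSmallPerturbation
      (p • (assemble C R * (assemble C R)ᵀ) * (assemble c O - assemble C R)) C R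
      (p * frobInner (assemble C R - assemble c O) (assemble C R - assemble c O)) where
  neg_le_sub i k hk U hU := by
    rw [block_smul_assemble_mul, block_smul_assemble_mul, frobInner_smul_right,
      frobInner_smul_right, ← mul_sub, ← mul_neg, frobInner_mul_left, toMat_transpose_mul,
      frobInner_one_left, frobInner_mul_left]
    exact mul_le_mul_of_nonneg_left (neg_frobInner_sub_self_le hk
      (mul_mem (transpose_mem_OGroup (toMat_mem (R i))) hU)) hp
  neg_le_rotation i U hU := by
    set E := 1 - (toMat (R i))ᵀ * U
    have hRU : toMat (R i) - U = toMat (R i) * E := by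
      rw [Matrix.mul_sub, ← Matrix.mul_assoc, toMat_mul_transpose, Matrix.mul_one, Matrix.one_mul]
    have hEmul := frobInner_one_sub (mul_mem (transpose_mem_OGroup (toMat_mem (R i))) hU)
      (isSymm_block_transpose_mul_sub (hsymm (C i)))
    rw [block_smul_assemble_mul, frobInner_smul_right, hRU, frobInner_mul_left, frobInner_mul_left,
      ← Matrix.mul_assoc, toMat_transpose_mul, Matrix.one_mul, hEmul]
    linarith [mul_le_mul_of_nonneg_left
      (neg_frobInner_mul_block_le (C := C) (c := c) (R := R) (O := O) hd (C i) E) hp]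

end MeanPart

section Scalar

variable {n K : ℕ} {κ κ' : GroupKind} {C c : Fin n → Fin K} {R : Fin n → groupOf 1 κ}
  {O : Fin n → groupOf 1 κ'}

lemma apply_eq_one_or_of_mem_OGroup_one {U : Matrix (Fin 1) (Fin 1) ℝ} (hU : U ∈ OGroup 1) :
    U 0 0 = 1 ∨ U 0 0 = -1 := by
  have hmul := congrFun (congrFun ((mem_OGroup_iff U).1 hU).1 0) 0
  rw [mul_apply, Fin.sum_univ_one, transpose_apply, one_apply_eq] at hmul
  exact mul_self_eq_one_iff.1 hmul

lemma frobInner_fin_one (X Y : Matrix (Fin 1) (Fin 1) ℝ) : frobInner X Y = X 0 0 * Y 0 0 := by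
  rw [frobInner_eq_sum, Fin.sum_univ_one, Fin.sum_univ_one]

lemma isSmallPerturbation_of_sum_abs_le {Y : Matrix (Fin n × Fin 1) (Fin K × Fin 1) ℝ} {δ : ℝ}
    (h : ∀ i, ∑ k, |block Y i k 0 0| ≤ δ) : IsSmallPerturbation Y C R δ where
  neg_le_sub i k hk U hU := by
    have hpair := (Finset.sum_le_sum_of_subset_of_nonneg (Finset.subset_univ {k, C i})
      fun k' _ _ => abs_nonneg (block Y i k' 0 0)).trans (h i)
    rw [Finset.sum_pair hk] at hpair
    have hk' := abs_le.1 (le_refl |block Y i k 0 0|)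
    have hC := abs_le.1 (le_refl |block Y i (C i) 0 0|)
    rw [frobInner_fin_one, frobInner_fin_one]
    rcases apply_eq_one_or_of_mem_OGroup_one (toMat_mem (R i)) with hR | hR <;>
      rcases apply_eq_one_or_of_mem_OGroup_one hU with hU | hU <;>
      rw [hR, hU] <;> linarith
  neg_le_rotation i U hU := by
    have hC := abs_le.1 ((Finset.single_le_sum (fun k _ => abs_nonneg (block Y i k 0 0))
      (Finset.mem_univ (C i))).trans (h i))
    rw [frobInner_fin_one, frobInner_fin_one, Matrix.sub_apply]
    rcases apply_eq_one_or_of_mem_OGroup_one (toMat_mem (R i)) with hR | hR <;>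
      rcases apply_eq_one_or_of_mem_OGroup_one hU with hU | hU <;>
      rw [hR, hU] <;> linarith

lemma abs_block_assemble_sub_le (j : Fin n) (k : Fin K) :
    |block (assemble c O - assemble C R) j k 0 0|
      ≤ block (assemble c O - assemble C R) j k 0 0 ^ 2 := by
  rw [block_sub, block_assemble, block_assemble, Matrix.sub_apply]
  rcases apply_eq_one_or_of_mem_OGroup_one (toMat_mem (O j)) with hO | hO <;>
    rcases apply_eq_one_or_of_mem_OGroup_one (toMat_mem (R j)) with hR | hR <;>
    split_ifs <;> simp only [hO, hR, Matrix.zero_apply] <;> norm_num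

lemma sum_abs_block_mul_le {M : Matrix (Fin n × Fin 1) (Fin n × Fin 1) ℝ} {P : ℝ}
    (hM : ∀ x y, |M x y| ≤ P) (i : Fin n) :
    ∑ k, |block (M * (assemble c O - assemble C R)) i k 0 0|
      ≤ P * frobInner (assemble c O - assemble C R) (assemble c O - assemble C R) := by
  simp only [frobInner_eq_sum_block, frobInner_fin_one, ← sq]
  rw [Finset.sum_comm, Finset.mul_sum]
  refine Finset.sum_le_sum fun k _ => ?_
  rw [block_mul, Matrix.sum_apply, Finset.mul_sum]
  refine (Finset.abs_sum_le_sum_abs _ _).trans (Finset.sum_le_sum fun j _ => ?_)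
  rw [mul_apply, Fin.sum_univ_one, abs_mul]
  exact mul_le_mul (hM _ _) (abs_block_assemble_sub_le j k) (abs_nonneg _)
    ((abs_nonneg _).trans (hM (i, 0) (j, 0)))

lemma isSmallPerturbation_of_abs_le {M : Matrix (Fin n × Fin 1) (Fin n × Fin 1) ℝ} {P : ℝ}
    (hM : ∀ x y, |M x y| ≤ P) :
    IsSmallPerturbation (M * (assemble c O - assemble C R)) C R
      (P * frobInner (assemble c O - assemble C R) (assemble c O - assemble C R)) :=
  isSmallPerturbation_of_sum_abs_le fun i => sum_abs_block_mul_le hM i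

end Scalar

section Symmetries

variable {n l K d : ℕ} {κ κ' : GroupKind}

/-- The symmetry `bdiag(U) (P ⊗ I_d)` of the model, where `P` is the permutation matrix of `σ`. -/
noncomputable def symMat (σ : Equiv.Perm (Fin K)) (U : Fin K → groupOf d κ) :
    Matrix (Fin K × Fin d) (Fin K × Fin d) ℝ :=
  bdiag U * kroneckerMap (fun x y => x * y) (σ.permMatrix ℝ) (1 : Matrix (Fin d) (Fin d) ℝ)

lemma symMat_apply (σ : Equiv.Perm (Fin K)) (U : Fin K → groupOf d κ) (x y : Fin K × Fin d) :
    symMat σ U x y = if σ x.1 = y.1 then toMat (U x.1) x.2 y.2 else 0 := by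
  obtain ⟨k, a⟩ := x
  obtain ⟨l, b⟩ := y
  simp only [symMat, mul_apply, bdiag, of_apply, kroneckerMap_apply, Fintype.sum_prod_type,
    Equiv.Perm.permMatrix, PEquiv.toMatrix_apply, Equiv.toPEquiv_apply, one_apply]
  rw [Finset.sum_eq_single k (fun k' _ hk' => by simp [hk'.symm]) (by simp),
    Finset.sum_eq_single b (fun b' _ hb' => by simp [hb']) (by simp)]
  simp [eq_comm]

lemma symMat_eq_assemble (σ : Equiv.Perm (Fin K)) (U : Fin K → groupOf d κ) :
    symMat σ U = assemble σ U := by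
  ext x y
  rw [symMat_apply, assemble, of_apply]

lemma block_ext {X Y : Matrix (Fin n × Fin d) (Fin K × Fin d) ℝ}
    (h : ∀ i k, block X i k = block Y i k) : X = Y := by
  ext x y
  exact congrFun₂ (h x.1 y.1) x.2 y.2

lemma block_one (k l : Fin K) :
    block (1 : Matrix (Fin K × Fin d) (Fin K × Fin d) ℝ) k l = if k = l then 1 else 0 := by
  ext a b
  by_cases h : k = l
  · simp only [block, of_apply, one_apply, Prod.mk.injEq, h, true_and, if_true]
  · simp only [block, of_apply, one_apply, Prod.mk.injEq, h, false_and, if_false, Matrix.zero_apply]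

lemma block_mul_symMat (X : Matrix (Fin n × Fin d) (Fin K × Fin d) ℝ) (σ : Equiv.Perm (Fin K))
    (U : Fin K → groupOf d κ) (i : Fin n) (k : Fin K) :
    block (X * symMat σ U) i (σ k) = block X i k * toMat (U k) := by
  rw [block_mul, symMat_eq_assemble, Finset.sum_eq_single k, block_assemble_self]
  · intro k' _ hk'
    rw [block_assemble_of_ne _ _ (σ.injective.ne hk'), Matrix.mul_zero]
  · simp

lemma symMat_mul_transpose (σ : Equiv.Perm (Fin K)) (U : Fin K → groupOf d κ) :
    symMat σ U * (symMat σ U)ᵀ = 1 := by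
  refine block_ext fun k l => ?_
  rw [symMat_eq_assemble, block_assemble_mul, block_transpose, block_assemble, block_one]
  split_ifs with h h' h'
  · rw [σ.injective h, toMat_mul_transpose]
  · exact absurd (σ.injective h).symm h'
  · exact absurd (congrArg σ h'.symm) h
  · rw [transpose_zero, Matrix.mul_zero]

/-- An element of the group, as an element of the orthogonal group. -/
def toOrth (g : groupOf d κ) : groupOf d .orthogonal := ⟨g.1, Subgroup.mem_top _⟩

/-- The group elements `R i * U (C i)` of the truth `assemble C R` transformed by `symMat σ U`. -/
def moveGroup (U : Fin K → groupOf d .orthogonal) (C : Fin n → Fin K) (R : Fin n → groupOf d κ)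
    (i : Fin n) : groupOf d .orthogonal := toOrth (R i) * U (C i)

lemma toMat_moveGroup (U : Fin K → groupOf d .orthogonal) (C : Fin n → Fin K)
    (R : Fin n → groupOf d κ) (i : Fin n) :
    toMat (moveGroup U C R i) = toMat (R i) * toMat (U (C i)) := rfl

lemma assemble_mul_symMat (C : Fin n → Fin K) (R : Fin n → groupOf d κ)
    (σ : Equiv.Perm (Fin K)) (U : Fin K → groupOf d .orthogonal) :
    assemble C R * symMat σ U = assemble (σ ∘ C) (moveGroup U C R) := by
  refine block_ext fun i k => ?_
  rw [block_assemble_mul, symMat_eq_assemble, block_assemble, block_assemble, mul_ite,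
    Matrix.mul_zero]
  rfl

lemma symMat_mul (σ τ : Equiv.Perm (Fin K)) (U T : Fin K → groupOf d .orthogonal) :
    symMat σ U * symMat τ T = symMat (σ.trans τ) (moveGroup T σ U) := by
  rw [symMat_eq_assemble σ, assemble_mul_symMat, symMat_eq_assemble]
  rfl

lemma symMat_one : symMat 1 (1 : Fin K → groupOf d κ) = 1 := by
  refine block_ext fun k l => ?_
  rw [symMat_eq_assemble, block_assemble, block_one]
  rfl

lemma frobInner_symMat_one_left (U : Fin K → groupOf d κ)
    (Z : Matrix (Fin K × Fin d) (Fin K × Fin d) ℝ) :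
    frobInner (symMat 1 U) Z = ∑ k, frobInner (toMat (U k)) (block Z k k) := by
  rw [symMat_eq_assemble, frobInner_assemble]
  rfl

lemma balanced_perm_comp {m : ℕ} {C : Fin n → Fin K} (h : Balanced m C)
    (σ : Equiv.Perm (Fin K)) : Balanced m (σ ∘ C) := fun k => by
  simpa only [Function.comp_apply, ← Equiv.eq_symm_apply] using h (σ.symm k)

lemma IsSeparated.mul_symMat {X : Matrix (Fin n × Fin d) (Fin K × Fin d) ℝ} {C : Fin n → Fin K}
    {R : Fin n → groupOf d κ} {g : Fin n → ℝ} {s : ℝ} (h : IsSeparated X C R g s)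
    (σ : Equiv.Perm (Fin K)) (U : Fin K → groupOf d .orthogonal) :
    IsSeparated (X * symMat σ U) (σ ∘ C) (moveGroup U C R) g s where
  pos := h.pos
  le_mul := h.le_mul
  block_eq i := by
    rw [Function.comp_apply, block_mul_symMat, h.block_eq, Matrix.smul_mul, toMat_moveGroup]
  le_sub i k hk G hG := by
    obtain ⟨k, rfl⟩ := σ.surjective k
    rw [block_mul_symMat, frobInner_mul_right]
    exact h.le_sub i k (fun hC => hk (congrArg σ hC)) _
      (mul_mem hG (transpose_mem_OGroup (toMat_mem _)))

end Symmetries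

section EstError

variable {n K d : ℕ} {Vstar X : Matrix (Fin n × Fin d) (Fin K × Fin d) ℝ}
  {σ : Equiv.Perm (Fin K)} {U : Fin K → groupOf d .orthogonal}

lemma estError_nonneg (Vstar X : Matrix (Fin n × Fin d) (Fin K × Fin d) ℝ) :
    0 ≤ estError .orthogonal Vstar X :=
  Real.iInf_nonneg fun _ => frobNorm_nonneg _

lemma estError_le (Vstar X : Matrix (Fin n × Fin d) (Fin K × Fin d) ℝ) (σ : Equiv.Perm (Fin K))
    (U : Fin K → groupOf d .orthogonal) :
    estError .orthogonal Vstar X ≤ frobNorm (X - Vstar * symMat σ U) :=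
  ciInf_le (f := fun Q : symGroup K d .orthogonal => frobNorm (X - Vstar * Q.1))
    ⟨0, Set.forall_mem_range.2 fun _ => frobNorm_nonneg _⟩ ⟨symMat σ U, U, σ, rfl⟩

lemma continuous_frobNorm_sub_mul_symMat (Vstar X : Matrix (Fin n × Fin d) (Fin K × Fin d) ℝ)
    (σ : Equiv.Perm (Fin K)) :
    Continuous fun U : Fin K → groupOf d .orthogonal => frobNorm (X - Vstar * symMat σ U) := by
  have hsym : Continuous fun U : Fin K → groupOf d .orthogonal => symMat σ U := by
    refine continuous_matrix fun x y => ?_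
    simp only [symMat_apply]
    split_ifs
    · exact (continuous_toMat.comp (continuous_apply x.1)).matrix_elem _ _
    · exact continuous_const
  have hsub := continuous_const (y := X).sub (continuous_const (y := Vstar).matrix_mul hsym)
  simp only [frobNorm_eq_sqrt]
  exact Real.continuous_sqrt.comp (hsub.matrix_transpose.matrix_mul hsub).matrix_trace

lemma exists_estError_eq (Vstar X : Matrix (Fin n × Fin d) (Fin K × Fin d) ℝ) :
    ∃ (σ : Equiv.Perm (Fin K)) (U : Fin K → groupOf d .orthogonal),
      estError .orthogonal Vstar X = frobNorm (X - Vstar * symMat σ U) := by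
  have hmin : ∀ σ : Equiv.Perm (Fin K), ∃ U : Fin K → groupOf d .orthogonal, ∀ U',
      frobNorm (X - Vstar * symMat σ U) ≤ frobNorm (X - Vstar * symMat σ U') := fun σ => by
    obtain ⟨U, -, hU⟩ := isCompact_univ.exists_isMinOn Set.univ_nonempty
      (continuous_frobNorm_sub_mul_symMat Vstar X σ).continuousOn
    exact ⟨U, fun U' => hU (Set.mem_univ U')⟩
  choose U hU using hmin
  obtain ⟨σ, hσ⟩ := Finite.exists_min fun σ => frobNorm (X - Vstar * symMat σ (U σ))
  have : Nonempty (symGroup K d .orthogonal) := ⟨⟨symMat σ (U σ), U σ, σ, rfl⟩⟩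
  refine ⟨σ, U σ, (estError_le Vstar X σ (U σ)).antisymm (le_ciInf ?_)⟩
  rintro ⟨_, U', σ', rfl⟩
  exact (hσ σ').trans (hU σ' U')

lemma frobInner_mul_symMat_self (Y : Matrix (Fin n × Fin d) (Fin K × Fin d) ℝ)
    (σ : Equiv.Perm (Fin K)) (U : Fin K → groupOf d .orthogonal) :
    frobInner (Y * symMat σ U) (Y * symMat σ U) = frobInner Y Y := by
  rw [frobInner_mul_right, Matrix.mul_assoc, symMat_mul_transpose, Matrix.mul_one]

lemma frobInner_mul_symMat_le
    (h : estError .orthogonal Vstar X = frobNorm (X - Vstar * symMat σ U))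
    (τ : Equiv.Perm (Fin K)) (T : Fin K → groupOf d .orthogonal) :
    frobInner X (Vstar * symMat σ U * symMat τ T) ≤ frobInner X (Vstar * symMat σ U) := by
  have hle := estError_le Vstar X (σ.trans τ) (moveGroup T σ U)
  rw [h, ← symMat_mul, ← Matrix.mul_assoc] at hle
  have hsq := pow_le_pow_left₀ (frobNorm_nonneg _) hle 2
  rw [frobNorm_sq, frobNorm_sq, frobInner_sub_self, frobInner_sub_self,
    frobInner_mul_symMat_self _ τ T] at hsq
  linarith

lemma isSymm_block_of_estError_eq
    (h : estError .orthogonal Vstar X = frobNorm (X - Vstar * symMat σ U)) (k : Fin K) :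
    (block ((Vstar * symMat σ U)ᵀ * X) k k).IsSymm := by
  refine isSymm_of_trace_max fun G hG => ?_
  let T : Fin K → groupOf d .orthogonal := Function.update 1 k ⟨⟨G, hG⟩, Subgroup.mem_top _⟩
  have hT : T k = ⟨⟨G, hG⟩, Subgroup.mem_top _⟩ := Function.update_self ..
  have hle : frobInner (symMat 1 T) ((Vstar * symMat σ U)ᵀ * X)
        ≤ frobInner (symMat 1 (1 : Fin K → groupOf d .orthogonal)) ((Vstar * symMat σ U)ᵀ * X) := by
    rw [symMat_one, frobInner_comm, frobInner_comm 1, ← frobInner_mul_left, ← frobInner_mul_left,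
      Matrix.mul_one]
    exact frobInner_mul_symMat_le h 1 T
  rw [frobInner_symMat_one_left, frobInner_symMat_one_left,
    ← Finset.add_sum_erase _ _ (Finset.mem_univ k), ← Finset.add_sum_erase _ _ (Finset.mem_univ k),
    hT, Finset.sum_congr rfl fun l hl => by
      rw [show T l = 1 from Function.update_of_ne (Finset.ne_of_mem_erase hl) ..]] at hle
  rw [← frobInner_one_left]
  exact le_of_add_le_add_right hle

end EstError

section MeanObservation

variable {n K d m : ℕ} {κ : GroupKind} {C : Fin n → Fin K} {p q : ℝ}

lemma block_mul_assemble (A : Matrix (Fin n × Fin d) (Fin n × Fin d) ℝ) (C : Fin n → Fin K)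
    (R : Fin n → groupOf d κ) (i : Fin n) (k : Fin K) :
    block (A * assemble C R) i k = ∑ j with C j = k, block A i j * toMat (R j) := by
  rw [block_mul, Finset.sum_filter]
  refine Finset.sum_congr rfl fun j _ => ?_
  rw [block_assemble, mul_ite, Matrix.mul_zero]

lemma block_mul_assemble_self {A : Matrix (Fin n × Fin d) (Fin n × Fin d) ℝ}
    {R : Fin n → groupOf d κ} {i : Fin n} {w : Fin n → ℝ}
    (h : ∀ j, C j = C i → block A i j = w j • (toMat (R i) * (toMat (R j))ᵀ)) :
    block (A * assemble C R) i (C i) = (∑ j with C j = C i, w j) • toMat (R i) := by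
  rw [block_mul_assemble, Finset.sum_smul]
  refine Finset.sum_congr rfl fun j hj => ?_
  rw [h j (Finset.mem_filter.1 hj).2, Matrix.smul_mul, Matrix.mul_assoc, toMat_transpose_mul,
    Matrix.mul_one]

lemma block_meanObservation (p q : ℝ) (C : Fin n → Fin K) (R : Fin n → groupOf d κ)
    (i j : Fin n) :
    block (meanObservation p q C R) i j
      = if C i = C j then p • (toMat (R i) * (toMat (R j))ᵀ) else q • meanMat d κ := by
  ext a b
  simp only [block, meanObservation, of_apply]
  split_ifs <;> rfl

lemma meanObservation_eq (h : ¬ (d = 1 ∧ κ = .specialOrthogonal)) (p q : ℝ) (C : Fin n → Fin K)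
    (R : Fin n → groupOf d κ) :
    meanObservation p q C R = p • (assemble C R * (assemble C R)ᵀ) := by
  refine block_ext fun i j => ?_
  rw [block_meanObservation, meanMat_eq_zero h, smul_zero, block_smul, block_assemble_mul,
    block_transpose, block_assemble]
  simp only [eq_comm (a := C i)]
  split_ifs
  · rfl
  · rw [transpose_zero, Matrix.mul_zero, smul_zero]

lemma abs_meanObservation_le (hp : 0 ≤ p) (hq : 0 ≤ q) (R : Fin n → groupOf 1 .specialOrthogonal)
    (x y : Fin n × Fin 1) : |meanObservation p q C R x y| ≤ max p q := by
  rw [meanObservation, of_apply, toMat_eq_one, toMat_eq_one, meanMat_eq_one, transpose_one,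
    Matrix.one_mul, Subsingleton.elim x.2 y.2, one_apply_eq, mul_one, mul_one]
  split_ifs
  · exact (abs_of_nonneg hp).trans_le (le_max_left p q)
  · exact (abs_of_nonneg hq).trans_le (le_max_right p q)

lemma block_meanObservation_mul_assemble_self (hC : Balanced m C) (p q : ℝ)
    (R : Fin n → groupOf d κ) (i : Fin n) :
    block (meanObservation p q C R * assemble C R) i (C i) = (m * p) • toMat (R i) := by
  rw [block_mul_assemble_self fun j hj => by rw [block_meanObservation, if_pos hj.symm],
    Finset.sum_const, hC, nsmul_eq_mul]

lemma block_meanObservation_mul_assemble_of_ne (hC : Balanced m C) (p q : ℝ)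
    (R : Fin n → groupOf 1 .specialOrthogonal) {i : Fin n} {k : Fin K} (hk : k ≠ C i) :
    block (meanObservation p q C R * assemble C R) i k = (m * q) • 1 := by
  have hblock : ∀ j ∈ Finset.univ.filter fun j => C j = k,
      block (meanObservation p q C R) i j * toMat (R j) = q • 1 := fun j hj => by
    rw [block_meanObservation, if_neg fun h => hk ((Finset.mem_filter.1 hj).2.symm.trans h.symm),
      meanMat_eq_one, toMat_eq_one, Matrix.mul_one]
  rw [block_mul_assemble, Finset.sum_congr rfl hblock, Finset.sum_const, hC,
    ← Nat.cast_smul_eq_nsmul ℝ, smul_smul]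

lemma frobNorm_assemble_mul_self (C c : Fin n → Fin K) (R : Fin n → groupOf d κ) :
    frobNorm (assemble c R) * frobNorm (assemble C R) = n * d := by
  rw [frobNorm_eq_sqrt, frobNorm_eq_sqrt, frobInner_assemble_self, frobInner_assemble_self,
    Real.mul_self_sqrt (by positivity)]

lemma frobInner_assemble_meanObservation_mul (hC : Balanced m C) (p q : ℝ)
    (R : Fin n → groupOf d κ) :
    frobInner (assemble C R) (meanObservation p q C R * assemble C R) = n * (m * p * d) := by
  simp only [frobInner_assemble, block_meanObservation_mul_assemble_self hC,
    frobInner_smul_right, frobInner_orthogonal_self (toMat_mem _), Finset.sum_const,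
    Finset.card_univ, Fintype.card_fin, nsmul_eq_mul]

end MeanObservation

section Separation

variable {n K d m : ℕ} {κ : GroupKind} {C : Fin n → Fin K} {p q s : ℝ}

lemma IsSeparated.frobInner_assemble {X : Matrix (Fin n × Fin d) (Fin K × Fin d) ℝ}
    {R : Fin n → groupOf d κ} {g : Fin n → ℝ} (h : IsSeparated X C R g s) :
    frobInner (assemble C R) X = ∑ i, d * g i := by
  rw [GPM.frobInner_assemble]
  refine Finset.sum_congr rfl fun i _ => ?_
  rw [h.block_eq, frobInner_smul_right, frobInner_orthogonal_self (toMat_mem _), mul_comm]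

-- On average, a row of the observation has about `m * p` neighbours in its own cluster.
lemma IsSeparated.le_mean {A : Matrix (Fin n × Fin d) (Fin n × Fin d) ℝ} {R : Fin n → groupOf d κ}
    {g : Fin n → ℝ} (h : IsSeparated (A * assemble C R) C R g s) (hC : Balanced m C) (hn : 0 < n) :
    s ≤ (m * p + ‖A - meanObservation p q C R‖) * d := by
  have hnoise := (abs_le.1 (abs_frobInner_mul_le (assemble C R) (A - meanObservation p q C R)
    (assemble C R))).2
  have hsum : ∑ _i : Fin n, s ≤ ∑ i, d * g i := Finset.sum_le_sum fun i _ => h.le_mul i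
  rw [Matrix.sub_mul, frobInner_sub_right, h.frobInner_assemble,
    frobInner_assemble_meanObservation_mul hC, frobNorm_assemble_mul_self] at hnoise
  rw [Finset.sum_const, Finset.card_univ, Fintype.card_fin, nsmul_eq_mul] at hsum
  refine le_of_mul_le_mul_left ?_ (Nat.cast_pos.2 hn)
  linarith

-- Without rotations, cross edges carry a signal: moving every vertex to another cluster would pay
-- off if `q` were much larger than `p`.
lemma IsSeparated.cross_prob_le {A : Matrix (Fin n × Fin 1) (Fin n × Fin 1) ℝ}
    {R : Fin n → groupOf 1 .specialOrthogonal} {g : Fin n → ℝ}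
    (h : IsSeparated (A * assemble C R) C R g s) (hC : Balanced m C) (hK : 2 ≤ K) (hn : 0 < n) :
    m * q ≤ m * p + 2 * ‖A - meanObservation p q C R‖ := by
  have : Nontrivial (Fin K) := Fin.nontrivial_iff_two_le.2 hK
  choose c hc using fun i => exists_ne (C i)
  have hadv : frobInner (assemble c R) (A * assemble C R) ≤ ∑ i, (1 : ℕ) * g i := by
    rw [GPM.frobInner_assemble]
    exact Finset.sum_le_sum fun i _ => by
      linarith [h.pos, h.le_sub i (c i) (hc i) _ (toMat_mem (R i))]
  have hmean : frobInner (assemble c R) (meanObservation p q C R * assemble C R) = n * (m * q) := by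
    simp only [GPM.frobInner_assemble, toMat_eq_one,
      block_meanObservation_mul_assemble_of_ne hC p q R (hc _), frobInner_smul_right,
      frobInner_orthogonal_self (one_mem _), Finset.sum_const, Finset.card_univ, Fintype.card_fin,
      nsmul_eq_mul, Nat.cast_one, mul_one]
  have htrue := (abs_le.1 (abs_frobInner_mul_le (assemble C R) (A - meanObservation p q C R)
    (assemble C R))).2
  have hmoved := (abs_le.1 (abs_frobInner_mul_le (assemble c R) (A - meanObservation p q C R)
    (assemble C R))).1
  rw [Matrix.sub_mul, frobInner_sub_right, h.frobInner_assemble,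
    frobInner_assemble_meanObservation_mul hC, frobNorm_assemble_mul_self] at htrue
  rw [Matrix.sub_mul, frobInner_sub_right, hmean, frobNorm_assemble_mul_self] at hmoved
  refine le_of_mul_le_mul_left ?_ (Nat.cast_pos.2 hn)
  push_cast at *
  linarith

end Separation

section OwnCluster

variable {n K d : ℕ} {κ : GroupKind} {C : Fin n → Fin K} {R : Fin n → groupOf d κ}
  {ω : Fin n × Fin n → Bool × groupOf d κ}

/-- The indicator that `i` and `j` are joined by an edge of the outcome `ω`, or equal. -/
noncomputable def edgeIndicator (ω : Fin n × Fin n → Bool × groupOf d κ) (i j : Fin n) : ℝ :=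
  if i = j ∨ (ω (min i j, max i j)).1 = true then 1 else 0

/-- The number of neighbours of `i` in its own cluster, counting `i` itself. -/
noncomputable def ownDegree (C : Fin n → Fin K) (ω : Fin n × Fin n → Bool × groupOf d κ)
    (i : Fin n) : ℝ :=
  ∑ j with C j = C i, edgeIndicator ω i j

lemma ownDegree_nonneg (C : Fin n → Fin K) (ω : Fin n × Fin n → Bool × groupOf d κ)
    (i : Fin n) : 0 ≤ ownDegree C ω i :=
  Finset.sum_nonneg fun j _ => by
    unfold edgeIndicator
    split_ifs <;> norm_num

lemma upperBlock_of_eq {i j : Fin n} (hC : C i = C j) :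
    upperBlock C R ω i j
      = (if (ω (i, j)).1 = true then (1 : ℝ) else 0) • (toMat (R i) * (toMat (R j))ᵀ) := by
  rw [upperBlock, if_pos hC]
  split_ifs
  · rw [one_smul]
  · rw [zero_smul]

lemma block_observation_of_eq {i j : Fin n} (hC : C j = C i) :
    block (observation C R ω) i j = edgeIndicator ω i j • (toMat (R i) * (toMat (R j))ᵀ) := by
  have hblock : block (observation C R ω) i j = if i = j then 1 else
      if i < j then upperBlock C R ω i j else (upperBlock C R ω j i)ᵀ := rfl
  rw [hblock, edgeIndicator]
  rcases lt_trichotomy i j with hij | rfl | hij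
  · rw [if_neg hij.ne, if_pos hij, upperBlock_of_eq hC.symm]
    simp only [hij.ne, false_or, min_eq_left hij.le, max_eq_right hij.le]
  · simp only [if_true, true_or, one_smul, toMat_mul_transpose]
  · rw [if_neg hij.ne', if_neg hij.not_gt, upperBlock_of_eq hC, transpose_smul, transpose_mul,
      transpose_transpose]
    simp only [hij.ne', false_or, min_eq_right hij.le, max_eq_left hij.le]

lemma block_observation_mul_assemble_self (i : Fin n) :
    block (observation C R ω * assemble C R) i (C i) = ownDegree C ω i • toMat (R i) :=
  block_mul_assemble_self fun _ => block_observation_of_eq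

lemma PreservesBySeparation.isSeparated {s : ℝ} (hK : 2 ≤ K)
    (h : PreservesBySeparation (observation C R ω) C (assemble C R) s) :
    IsSeparated (observation C R ω * assemble C R) C R (ownDegree C ω) s := by
  have hown : ∀ i, blockNuclear (observation C R ω * assemble C R) i (C i)
      = d * ownDegree C ω i := fun i => by
    rw [blockNuclear, of_apply, block_observation_mul_assemble_self,
      nuclearNorm_smul_orthogonal (toMat_mem _) (ownDegree_nonneg C ω i)]
  have : Nontrivial (Fin K) := Fin.nontrivial_iff_two_le.2 hK
  refine ⟨h.1, fun i => ?_, block_observation_mul_assemble_self, fun i k hk U hU => ?_⟩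
  · obtain ⟨k, hk⟩ := exists_ne (C i)
    exact hown i ▸ (h.2 i k hk).trans (sub_le_self _ (nuclearNorm_nonneg _))
  · exact hown i ▸ (h.2 i k hk).trans
      (sub_le_sub_left (frobInner_le_nuclearNorm hU (block _ i k)) _)

end OwnCluster

section Step

variable {n K d m : ℕ} {κ : GroupKind} {C c : Fin n → Fin K} {R : Fin n → groupOf d κ}
  {O : Fin n → groupOf d .orthogonal} {p q χ : ℝ}

lemma IsProj.frobInner_le {X : Matrix (Fin n × Fin d) (Fin K × Fin d) ℝ}
    {R : Fin n → groupOf d .orthogonal} (h : IsProj m X (assemble c O)) (hC : Balanced m C) :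
    frobInner (assemble C R) X ≤ frobInner (assemble c O) X := by
  have hdist := pow_le_pow_left₀ (frobNorm_nonneg _) (h.2 _ ⟨C, R, hC, rfl⟩) 2
  rw [frobNorm_sq, frobNorm_sq, frobInner_sub_self, frobInner_sub_self, frobInner_assemble_self,
    frobInner_assemble_self] at hdist
  linarith

lemma isSmallPerturbation_meanObservation (hd : 1 ≤ d) (hp : 0 ≤ p) (hq : 0 ≤ q)
    (hqp : d = 1 ∧ κ = .specialOrthogonal → q ≤ 2 * p) {σ : Equiv.Perm (Fin K)}
    {U : Fin K → groupOf d .orthogonal}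
    (h : estError .orthogonal (assemble C R) (assemble c O)
      = frobNorm (assemble c O - assemble C R * symMat σ U)) :
    IsSmallPerturbation
      (meanObservation p q C R * (assemble c O - assemble (σ ∘ C) (moveGroup U C R)))
      (σ ∘ C) (moveGroup U C R)
      (2 * p * estError .orthogonal (assemble C R) (assemble c O) ^ 2) := by
  have hsymm := isSymm_block_of_estError_eq h
  rw [assemble_mul_symMat] at h hsymm
  rw [h]
  by_cases hcase : d = 1 ∧ κ = .specialOrthogonal
  · obtain ⟨rfl, rfl⟩ := hcase
    have hpq : max p q ≤ 2 * p := max_le (by linarith) (hqp ⟨rfl, rfl⟩)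
    rw [frobNorm_sq]
    exact (isSmallPerturbation_of_abs_le fun x y => abs_meanObservation_le hp hq R x y).mono
      (mul_le_mul_of_nonneg_right hpq (frobInner_self_nonneg _))
  · have hgram : assemble C R * (assemble C R)ᵀ
        = assemble (σ ∘ C) (moveGroup U C R) * (assemble (σ ∘ C) (moveGroup U C R))ᵀ := by
      rw [← assemble_mul_symMat, transpose_mul, Matrix.mul_assoc, ← Matrix.mul_assoc (symMat σ U),
        symMat_mul_transpose, Matrix.one_mul]
    rw [meanObservation_eq hcase, hgram, frobNorm_sub_comm, frobNorm_sq]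
    exact (isSmallPerturbation_smul_mul_transpose hd hp hsymm).mono
      (mul_le_mul_of_nonneg_right (by linarith) (frobInner_self_nonneg _))

lemma perturbation_budget {ε : ℝ} (hd : 1 ≤ d) (hp : 0 ≤ p) (hχ₀ : 0 ≤ χ) (hχ : χ ≤ 2 * d)
    (hε : 8 * d ^ 2 * ε ^ 2 ≤ m * χ ^ 2) : 2 * d * (2 * p * ε ^ 2) ≤ χ * m * p := by
  have hd0 : (0 : ℝ) < d := by exact_mod_cast hd
  refine le_of_mul_le_mul_left ?_ hd0
  calc d * (2 * d * (2 * p * ε ^ 2)) = 8 * d ^ 2 * ε ^ 2 * (p / 2) := by ring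
    _ ≤ m * χ ^ 2 * (p / 2) := mul_le_mul_of_nonneg_right hε (by positivity)
    _ = χ * m * p * (χ / 2) := by ring
    _ ≤ χ * m * p * d := mul_le_mul_of_nonneg_left (by linarith) (by positivity)
    _ = d * (χ * m * p) := mul_comm _ _

lemma IsSeparated.le_two_mul {A : Matrix (Fin n × Fin d) (Fin n × Fin d) ℝ} {g : Fin n → ℝ}
    (h : IsSeparated (A * assemble C R) C R g (χ * m * p)) (hC : Balanced m C) (hn : 0 < n)
    (hmp : 0 < m * p) (hA : 2 * ‖A - meanObservation p q C R‖ ≤ m * p) : χ ≤ 2 * d := by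
  refine le_of_mul_le_mul_right ?_ hmp
  calc χ * (m * p) = χ * m * p := (mul_assoc _ _ _).symm
    _ ≤ (m * p + ‖A - meanObservation p q C R‖) * d := h.le_mean hC hn
    _ ≤ (m * p + m * p) * d :=
        mul_le_mul_of_nonneg_right (by linarith [norm_nonneg (A - meanObservation p q C R)])
          (Nat.cast_nonneg d)
    _ = 2 * d * (m * p) := by ring

lemma IsSeparated.cross_prob_le_two_mul {A : Matrix (Fin n × Fin d) (Fin n × Fin d) ℝ}
    {g : Fin n → ℝ} {s : ℝ} (h : IsSeparated (A * assemble C R) C R g s) (hC : Balanced m C)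
    (hK : 2 ≤ K) (hn : 0 < n) (hm : 0 < m) (hA : 2 * ‖A - meanObservation p q C R‖ ≤ m * p)
    (hscalar : d = 1 ∧ κ = .specialOrthogonal) : q ≤ 2 * p := by
  obtain ⟨rfl, rfl⟩ := hscalar
  have hcross := h.cross_prob_le hC hK hn (p := p) (q := q)
  refine le_of_mul_le_mul_left ?_ (Nat.cast_pos.2 hm : (0 : ℝ) < m)
  linarith

lemma IsSeparated.estError_le_half {A : Matrix (Fin n × Fin d) (Fin n × Fin d) ℝ} {g : Fin n → ℝ}
    (h : IsSeparated (A * assemble C R) C R g (χ * m * p)) (hK : 2 ≤ K) (hd : 1 ≤ d) (hn : 0 < n)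
    (hC : Balanced m C) (hp : 0 < p) (hq : 0 ≤ q)
    (hmean : 2 * ‖A - meanObservation p q C R‖ ≤ m * p)
    (hsep : 8 * d * ‖A - meanObservation p q C R‖ ≤ χ * m * p)
    {V W : Matrix (Fin n × Fin d) (Fin K × Fin d) ℝ} (hV : V ∈ relaxed n K d m)
    (hW : IsProj m (A * V) W)
    (hε : 8 * d ^ 2 * estError .orthogonal (assemble C R) V ^ 2 ≤ m * χ ^ 2) :
    estError .orthogonal (assemble C R) W ≤ 1 / 2 * estError .orthogonal (assemble C R) V := by
  obtain ⟨c, O, -, rfl⟩ := hV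
  obtain ⟨c', O', -, rfl⟩ := hW.1
  have : (0 : ℝ) < d := Nat.cast_pos.2 hd
  have hχm : 0 < χ * m := pos_of_mul_pos_left h.pos hp.le
  have hχ : 0 < χ := pos_of_mul_pos_left hχm (Nat.cast_nonneg m)
  have hm : (0 : ℝ) < m := pos_of_mul_pos_right hχm hχ.le
  obtain ⟨σ, U, hU⟩ := exists_estError_eq (assemble C R) (assemble c O)
  have hsepU := h.mul_symMat σ U
  rw [Matrix.mul_assoc, assemble_mul_symMat] at hsepU
  have hpert := isSmallPerturbation_meanObservation hd hp.le hq
    (h.cross_prob_le_two_mul hC hK hn (Nat.cast_pos.1 hm) hmean) hU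
  have hbudget := perturbation_budget hd hp.le hχ.le
    (h.le_two_mul hC hn (mul_pos hm hp) hmean) hε
  have hstep := hsepU.mul_frobNorm_sub_le hd hpert hbudget
    (hW.frobInner_le (balanced_perm_comp hC σ))
  have hnext := estError_le (assemble C R) (assemble c' O') σ U
  rw [← assemble_mul_symMat, frobNorm_sub_comm, ← hU] at hstep
  refine hnext.trans (le_of_mul_le_mul_left (hstep.trans ?_) (div_pos h.pos (by positivity)))
  calc ‖A - meanObservation p q C R‖ * estError .orthogonal (assemble C R) (assemble c O)
      ≤ χ * m * p / (8 * d) * estError .orthogonal (assemble C R) (assemble c O) :=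
        mul_le_mul_of_nonneg_right ((le_div_iff₀' (by positivity)).2 hsep) (estError_nonneg _ _)
    _ = χ * m * p / (4 * d) * (1 / 2 * estError .orthogonal (assemble C R) (assemble c O)) := by
        field_simp
        ring

lemma IsGPMSequence.mem_relaxed {A : Matrix (Fin n × Fin d) (Fin n × Fin d) ℝ}
    {V : ℕ → Matrix (Fin n × Fin d) (Fin K × Fin d) ℝ} (h : IsGPMSequence m A V) :
    ∀ t, V t ∈ relaxed n K d m
  | 0 => h.1
  | t + 1 => (h.2 t).1

lemma IsGPMSequence.estError_le_half {A : Matrix (Fin n × Fin d) (Fin n × Fin d) ℝ}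
    {V : ℕ → Matrix (Fin n × Fin d) (Fin K × Fin d) ℝ} {g : Fin n → ℝ} (hV : IsGPMSequence m A V)
    (h : IsSeparated (A * assemble C R) C R g (χ * m * p)) (hK : 2 ≤ K) (hd : 1 ≤ d) (hn : 0 < n)
    (hC : Balanced m C) (hp : 0 < p) (hq : 0 ≤ q)
    (hmean : 2 * ‖A - meanObservation p q C R‖ ≤ m * p)
    (hsep : 8 * d * ‖A - meanObservation p q C R‖ ≤ χ * m * p)
    (hε : 8 * d ^ 2 * estError .orthogonal (assemble C R) (V 0) ^ 2 ≤ m * χ ^ 2) (t : ℕ) :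
    estError .orthogonal (assemble C R) (V (t + 1))
      ≤ 1 / 2 * estError .orthogonal (assemble C R) (V t) := by
  have hstep := fun t => h.estError_le_half hK hd hn hC hp hq hmean hsep (hV.mem_relaxed t) (hV.2 t)
  refine hstep t ?_
  induction t with
  | zero => exact hε
  | succ t ih =>
    have hle : estError .orthogonal (assemble C R) (V (t + 1))
        ≤ estError .orthogonal (assemble C R) (V t) := by
      linarith [hstep t ih, estError_nonneg (assemble C R) (V t)]
    exact (mul_le_mul_of_nonneg_left (pow_le_pow_left₀ (estError_nonneg _ _) hle 2)
      (by positivity)).trans ih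

lemma sq_estError_le_of_le_div {x ρ ε : ℝ} (hχ : 0 < χ) (hx : 0 ≤ x) (hε : 0 ≤ ε)
    (hρ : 2 * √2 * √(d ^ 2 / χ ^ 2 + x) < ρ) (h : ε ≤ √m / ρ) :
    8 * d ^ 2 * ε ^ 2 ≤ m * χ ^ 2 := by
  have hbase : 0 ≤ 2 * √2 * √(d ^ 2 / χ ^ 2 + x) := by positivity
  have hρ_pos : 0 < ρ := hbase.trans_lt hρ
  have hρ_sq : 8 * d ^ 2 / χ ^ 2 ≤ ρ ^ 2 := by
    have hsq := pow_le_pow_left₀ hbase hρ.le 2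
    rw [mul_pow, mul_pow, Real.sq_sqrt zero_le_two, Real.sq_sqrt (by positivity)] at hsq
    rw [mul_div_assoc]
    linarith
  have hε_sq : ε ^ 2 * ρ ^ 2 ≤ m := by
    have hsq := pow_le_pow_left₀ hε h 2
    rwa [div_pow, Real.sq_sqrt (Nat.cast_nonneg m), le_div_iff₀ (by positivity)] at hsq
  rw [div_le_iff₀ (by positivity)] at hρ_sq
  calc 8 * d ^ 2 * ε ^ 2 ≤ ρ ^ 2 * χ ^ 2 * ε ^ 2 := mul_le_mul_of_nonneg_right hρ_sq (sq_nonneg ε)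
    _ = ε ^ 2 * ρ ^ 2 * χ ^ 2 := by ring
    _ ≤ m * χ ^ 2 := mul_le_mul_of_nonneg_right hε_sq (sq_nonneg χ)

end Step

section Concentration

lemma eventually_mul_log_le (B : ℝ) : ∀ᶠ n : ℕ in atTop, B * Real.log n ≤ n := by
  have hlog := (Real.isLittleO_log_id_atTop.const_mul_left B).bound one_pos
  filter_upwards [tendsto_natCast_atTop_atTop.eventually hlog] with n hn
  simpa only [one_mul, id_eq, Real.norm_natCast] using (le_abs_self _).trans hn

lemma measure_norm_observation_sub_gt_le {n K d : ℕ} {κ : GroupKind} {p q s t : ℝ}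
    (hp : p ∈ Set.Icc (0 : ℝ) 1) (hq : q ∈ Set.Icc (0 : ℝ) 1) (hst : 1 + 2 * d ^ 2 * s ≤ t)
    (C : Fin n → Fin K) (R : Fin n → groupOf d κ) :
    sgbmMeasure d κ p q C {ω | t < ‖observation C R ω - meanObservation p q C R‖}
      ≤ ∑ x : Fin d × Fin d, sgbmMeasure d κ p q C {ω | s < ‖noiseMatrix p q C R x.1 x.2 ω‖} := by
  refine (measure_mono fun ω hω => ?_).trans (measure_iUnion_fintype_le _ _)
  by_contra hsmall
  simp only [Set.mem_iUnion, Set.mem_ofPred_eq, not_exists, not_lt, Prod.forall] at hsmall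
  exact ((norm_observation_sub_meanObservation_le hp hq C R ω hsmall).trans hst).not_gt hω

lemma natCast_mul_ofReal_rpow_le {k n : ℕ} (hk : k ≤ n) (hn : 0 < n) (c : ℝ) :
    k * ENNReal.ofReal ((n : ℝ) ^ (-(c + 1))) ≤ ENNReal.ofReal ((n : ℝ) ^ (-c)) := by
  have hn0 : (0 : ℝ) < n := Nat.cast_pos.2 hn
  rw [← ENNReal.ofReal_natCast, ← ENNReal.ofReal_mul (Nat.cast_nonneg k)]
  refine ENNReal.ofReal_le_ofReal ?_
  calc (k : ℝ) * (n : ℝ) ^ (-(c + 1)) ≤ n * (n : ℝ) ^ (-(c + 1)) := by gcongr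
    _ = (n : ℝ) ^ (-c) := by
        rw [mul_comm, ← Real.rpow_add_one hn0.ne', neg_add, neg_add_cancel_right]

lemma eventually_measure_norm_observation_sub_gt_le (d : ℕ) {B η c : ℝ} (hB : 0 ≤ B) (hη : 0 < η)
    (hc : 0 ≤ c) : ∀ᶠ n : ℕ in atTop, ∀ {K : ℕ} {κ : GroupKind} {p q : ℝ},
      p ∈ Set.Icc 0 (B * Real.log n / n) → q ∈ Set.Icc 0 (B * Real.log n / n) →
      ∀ (C : Fin n → Fin K) (R : Fin n → groupOf d κ), sgbmMeasure d κ p q C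
        {ω | η * Real.log n < ‖observation C R ω - meanObservation p q C R‖}
        ≤ ENNReal.ofReal ((n : ℝ) ^ (-c)) := by
  obtain ⟨σ, hσ, hdσ⟩ : ∃ σ : ℝ, 0 < σ ∧ 2 * d ^ 2 * σ ≤ η / 2 := by
    refine ⟨η / (4 * (d ^ 2 + 1)), by positivity, ?_⟩
    rw [mul_div_assoc', div_le_iff₀ (by positivity)]
    linarith
  filter_upwards [eventually_measure_l2_opNorm_gt_le hB hσ (add_nonneg hc zero_le_one),
    eventually_mul_log_le B, eventually_ge_atTop (d * d), eventually_gt_atTop 0,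
    tendsto_log_natCast_atTop.eventually_ge_atTop (2 / η)]
    with n hnoise hBn hdn hn hlog K κ p q hp hq C R
  have hn0 : (0 : ℝ) < n := Nat.cast_pos.2 hn
  have hle_one : B * Real.log n / n ≤ 1 := (div_le_one hn0).2 hBn
  have hp1 : p ∈ Set.Icc (0 : ℝ) 1 := ⟨hp.1, hp.2.trans hle_one⟩
  have hq1 : q ∈ Set.Icc (0 : ℝ) 1 := ⟨hq.1, hq.2.trans hle_one⟩
  have hpq : max p q * n ≤ B * Real.log n := (le_div_iff₀ hn0).1 (max_le hp.2 hq.2)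
  have hthreshold : 1 + 2 * d ^ 2 * (σ * Real.log n) ≤ η * Real.log n := by
    rw [div_le_iff₀' hη] at hlog
    linarith [mul_le_mul_of_nonneg_right hdσ (Real.log_natCast_nonneg n)]
  calc _ ≤ ∑ x : Fin d × Fin d, sgbmMeasure d κ p q C
        {ω | σ * Real.log n < ‖noiseMatrix p q C R x.1 x.2 ω‖} :=
        measure_norm_observation_sub_gt_le hp1 hq1 hthreshold C R
    _ ≤ ∑ _x : Fin d × Fin d, ENNReal.ofReal ((n : ℝ) ^ (-(c + 1))) :=
        Finset.sum_le_sum fun x _ => hnoise (isCenteredNoise_noiseMatrix C R x.1 x.2 hp1 hq1)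
          (hp.1.trans (le_max_left p q)) hpq
    _ = (d * d : ℕ) * ENNReal.ofReal ((n : ℝ) ^ (-(c + 1))) := by
        rw [Finset.sum_const, Finset.card_univ, Fintype.card_prod, Fintype.card_fin, nsmul_eq_mul]
    _ ≤ ENNReal.ofReal ((n : ℝ) ^ (-c)) := natCast_mul_ofReal_rpow_le hdn hn c

lemma mul_log_div_mem_Icc {a b α : ℝ} (h : α ∈ Set.Icc a b) (n : ℕ) :
    α * Real.log n / n ∈ Set.Icc (a * Real.log n / n) (b * Real.log n / n) := by
  have := Real.log_natCast_nonneg n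
  exact ⟨by gcongr; exact h.1, by gcongr; exact h.2⟩

lemma exists_noise_level {K d : ℕ} {a χ₀ : ℝ} (hK : 0 < K) (hd : 0 < d) (ha : 0 < a)
    (hχ₀ : 0 < χ₀) : ∃ η : ℝ, 0 < η ∧ ∀ {n m : ℕ} {p χ ν : ℝ}, n = K * m → 0 < n →
      a * Real.log n / n ≤ p → χ₀ ≤ χ → ν ≤ η * Real.log n →
      2 * ν ≤ m * p ∧ 8 * d * ν ≤ χ * m * p := by
  have hK0 : (0 : ℝ) < K := Nat.cast_pos.2 hK
  have : (0 : ℝ) < d := Nat.cast_pos.2 hd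
  set r := min (χ₀ / (8 * d)) (1 / 2)
  have hr : 0 < r := lt_min (by positivity) (by norm_num)
  refine ⟨r * a / K, by positivity, fun {n m p χ ν} hnm hn hp hχ hν => ?_⟩
  have hn0 : (0 : ℝ) < n := Nat.cast_pos.2 hn
  have hmp : a * Real.log n / K ≤ m * p := by
    have hm : (n : ℝ) = K * m := by exact_mod_cast hnm
    rw [div_le_iff₀ hn0] at hp
    rw [div_le_iff₀ hK0]
    linarith [congrArg (p * ·) hm]
  have hmp0 : 0 ≤ m * p :=
    (div_nonneg (mul_nonneg ha.le (Real.log_natCast_nonneg n)) hK0.le).trans hmp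
  have hνr : ν ≤ r * (m * p) := by
    calc ν ≤ r * a / K * Real.log n := hν
      _ = r * (a * Real.log n / K) := by ring
      _ ≤ r * (m * p) := mul_le_mul_of_nonneg_left hmp hr.le
  have hhalf : ν ≤ 1 / 2 * (m * p) :=
    hνr.trans (mul_le_mul_of_nonneg_right (min_le_right _ _) hmp0)
  have hχν : ν ≤ χ / (8 * d) * (m * p) :=
    hνr.trans (mul_le_mul_of_nonneg_right ((min_le_left _ _).trans (by gcongr)) hmp0)
  refine ⟨by linarith, ?_⟩
  rwa [mul_assoc χ, ← le_div_iff₀' (by positivity), mul_div_right_comm]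

end Concentration

end GPM

theorem theorem4_general (κ : GPM.GroupKind) (K d : ℕ) (hK : 2 ≤ K) (hd : 1 ≤ d)
    (a b : ℝ) (ha : 0 < a) (hab : a ≤ b) (c : ℝ) (hc : 0 ≤ c) (χ₀ : ℝ) (hχ₀ : 0 < χ₀) :
    ∃ N : ℕ, ∀ n m : ℕ, n = K * m → N ≤ n →
      ∀ α ∈ Set.Icc a b, ∀ β ∈ Set.Icc 0 b,
      ∀ p q : ℝ, p = α * Real.log n / n → q = β * Real.log n / n →
      ∀ (C : Fin n → Fin K) (R : Fin n → GPM.groupOf d κ), GPM.Balanced m C →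
      GPM.sgbmMeasure d κ p q C
        {ω | ¬ ∀ (χ : ℝ) (V : ℕ → Matrix (Fin n × Fin d) (Fin K × Fin d) ℝ),
          χ₀ ≤ χ →
          GPM.IsGPMSequence m (GPM.observation C R ω) V →
          GPM.PreservesBySeparation (GPM.observation C R ω) C (GPM.assemble C R) (χ * m * p) →
          8 * d ^ 2 * GPM.estError GPM.GroupKind.orthogonal (GPM.assemble C R) (V 0) ^ 2
            ≤ m * χ ^ 2 →
          ∀ t : ℕ, GPM.estError GPM.GroupKind.orthogonal (GPM.assemble C R) (V (t + 1))
            ≤ 1 / 2 * GPM.estError GPM.GroupKind.orthogonal (GPM.assemble C R) (V t)}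
      ≤ ENNReal.ofReal ((n : ℝ) ^ (-c)) := by
  obtain ⟨η, hη, hlevel⟩ := GPM.exists_noise_level (by omega : 0 < K) hd ha hχ₀
  obtain ⟨N, hN⟩ := Filter.eventually_atTop.1
    (GPM.eventually_measure_norm_observation_sub_gt_le d (ha.le.trans hab) hη hc)
  refine ⟨max N 2, fun n m hnm hn α hα β hβ p q hp hq C R hC => ?_⟩
  have hp_mem := hp ▸ GPM.mul_log_div_mem_Icc hα n
  have hq_mem : q ∈ Set.Icc 0 (b * Real.log n / n) := by
    simpa only [hq, zero_mul, zero_div] using GPM.mul_log_div_mem_Icc hβ n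
  have hn2 : 2 ≤ n := (le_max_right N 2).trans hn
  have hn0 : 0 < n := by omega
  have hlog : 0 < Real.log n := Real.log_pos (by exact_mod_cast hn2)
  have hp0 : 0 < p := lt_of_lt_of_le (by positivity) hp_mem.1
  refine le_trans (MeasureTheory.measure_mono fun ω hω => ?_)
    (hN n ((le_max_left N 2).trans hn) ⟨hp0.le, hp_mem.2⟩ hq_mem C R)
  by_contra hsmall
  refine hω fun χ V hχ hV hsep hε t => ?_
  obtain ⟨hmean, hmargin⟩ := hlevel hnm hn0 hp_mem.1 hχ (not_lt.1 hsmall)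
  exact hV.estError_le_half (hsep.isSeparated hK) hK hd hn0 hC hp0 hq_mem.1 hmean hmargin hε t

theorem theorem4 (κ : GPM.GroupKind) (K d : ℕ) (hK : 2 ≤ K) (hd : 1 ≤ d)
    (a b : ℝ) (ha : 0 < a) (hab : a ≤ b) :
    ∃ c : ℝ, 0 < c ∧ ∀ χ₀ : ℝ, 0 < χ₀ → ∃ N : ℕ,
      ∀ (n m : ℕ), n = K * m → N ≤ n →
      ∀ (α β : ℝ), α ∈ Set.Icc a b → β ∈ Set.Icc a b →
      ∀ (p q : ℝ), p = α * Real.log n / n → q = β * Real.log n / n →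
      ∀ (C : Fin n → Fin K) (R : Fin n → GPM.groupOf d κ), GPM.Balanced m C →
      GPM.sgbmMeasure d κ p q C
        {ω | ¬ ∀ (χ : ℝ) (V : ℕ → Matrix (Fin n × Fin d) (Fin K × Fin d) ℝ),
          χ₀ ≤ χ →
          GPM.IsGPMSequence m (GPM.observation C R ω) V →
          GPM.PreservesBySeparation (GPM.observation C R ω) C (GPM.assemble C R) (χ * m * p) →
          (∀ i, Real.sqrt (2 * K * β) / α * m * p
            ≤ GPM.blockNuclear (GPM.observation C R ω * GPM.assemble C R) i (C i)) →
          (∃ ρ : ℝ, 2 * Real.sqrt 2 * Real.sqrt (d ^ 2 / χ ^ 2 + α ^ 2 / (2 * K * β)) < ρ ∧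
            GPM.estError GPM.GroupKind.orthogonal (GPM.assemble C R) (V 0)
              ≤ Real.sqrt m / ρ) →
          ∀ t : ℕ, GPM.estError GPM.GroupKind.orthogonal (GPM.assemble C R) (V (t + 1))
            ≤ 1 / 2 * GPM.estError GPM.GroupKind.orthogonal (GPM.assemble C R) (V t)}
      ≤ ENNReal.ofReal ((n : ℝ) ^ (-c)) := by
  refine ⟨1, one_pos, fun χ₀ hχ₀ => ?_⟩
  obtain ⟨N, hN⟩ := theorem4_general κ K d hK hd a b ha hab 1 zero_le_one χ₀ hχ₀
  refine ⟨N, fun n m hnm hn α β hα hβ p q hp hq C R hC => ?_⟩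
  have hβ0 : 0 < β := ha.trans_le hβ.1
  refine (MeasureTheory.measure_mono ?_).trans
    (hN n m hnm hn α hα β ⟨hβ0.le, hβ.2⟩ p q hp hq C R hC)
  exact fun ω hω hgood => hω fun χ V hχ hV hsep _ ⟨ρ, hρ, hε⟩ => hgood χ V hχ hV hsep
    (GPM.sq_estError_le_of_le_div (hχ₀.trans_le hχ) (by positivity) (GPM.estError_nonneg _ _) hρ hε)
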